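/- Let $A\in\mathbb{R}^{N\times N}$, $B\in\mathbb{R}^{N\times q}$, $x_0\in\mathbb{R}^N$, let $Q\in\mathbb{R}^{N\times N}$ be symmetric positive semi-definite and $R\in\mathbb{R}^{q\times q}$ symmetric positive definite, let $T>0$ and $x_d\in L^2(0,T;\mathbb{R}^N)$. For $u\in L^2(0,T;\mathbb{R}^q)$ put $$J(u)=\tfrac12\int_0^T\big((x-x_d)^\top Q(x-x_d)+u^\top Ru\big)\,dt,\qquad \dot x=Ax+Bu,\quad x(0)=x_0 .$$ Then there is a constant $C$, depending only on $A,B,x_0,Q,R,x_d,T$, such that the following holds. Let $A=\sum_{m=1}^M A_m$ with $\langle x,A_mx\rangle\le 0$ for all $m$ and all $x\in\mathbb{R}^N$. Let $(p_S)_{S\subseteq\{1,\dots,M\}}$ be probabilities ($p_S\ge 0$, $\sum_S p_S=1$) such that $\pi_m:=\sum_{S\ni m}p_S>0$ for every $m$. Let $0=t_0<t_1<\dots<t_K=T$ and $h:=\max_k(t_k-t_{k-1})$. For $\omega=(\omega_1,\dots,\omega_K)$ with $\omega_k\subseteq\{1,\dots,M\}$ let $\mathcal{A}_h(\omega,t):=\sum_{m\in\omega_k}A_m/\pi_m$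 for $t\in[t_{k-1},t_k)$, let $$J_h(\omega,u)=\tfrac12\int_0^T\big((x_h-x_d)^\top Q(x_h-x_d)+u^\top Ru\big)\,dt,\qquad \dot x_h=\mathcal{A}_h(\omega,t)x_h+Bu,\quad x_h(0)=x_0,$$ let $\mathbb{E}[X]:=\sum_\omega X(\omega)\,p_{\omega_1}\cdots p_{\omega_K}$, and let $\mathrm{Var}[\mathcal{A}]:=\sum_S\big\|\sum_{m\in S}A_m/\pi_m-A\big\|^2p_S$, where $\|\cdot\|$ is the Euclidean operator norm. Let $u^*$ be the minimizer of $J$ and, for every $\omega$, let $u_h^*(\omega)$ be the minimizer of $J_h(\omega,\cdot)$, both over $L^2(0,T;\mathbb{R}^q)$. (i) If $\alpha\ge 0$ and $J_h(\omega,\cdot)$ is $\alpha$-convex for every $\omega$, that is, $J_h(\omega,(1-\theta)u+\theta v)\le(1-\theta)J_h(\omega,u)+\theta J_h(\omega,v)-\tfrac{\alpha}{2}\theta(1-\theta)|u-v|^2_{L^2(0,T)}$ for all $u,v\in L^2(0,T;\mathbb{R}^q)$ and $\theta\in[0,1]$, then $$\alpha^2\,\mathbb{E}\big[|u_h^*-u^*|^2_{L^2(0,T;\mathbb{R}^q)}\big]\le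 C\,h\,\mathrm{Var}[\mathcal{A}].$$ (ii) Moreover, $\mathbb{E}\big[|u_h^*-u^*|^2_{L^2(0,T;\mathbb{R}^q)}\big]\le C\,h\,\mathrm{Var}[\mathcal{A}]$ (without any further assumption). -/

import Mathlib

open MeasureTheory

namespace RandomSplitting

/-- The Hilbert space `L²(0,T; ℝⁿ)`. -/
abbrev L2 (T : ℝ) (n : ℕ) : Type :=
  Lp (EuclideanSpace ℝ (Fin n)) 2 (volume.restrict (Set.Ioc 0 T))

section Dynamics

variable {N q : ℕ}

/-- `x` is the (absolutely continuous) solution on `[0,T]` of `x' = 𝒜(t) x + B u(t)`, `x(0) = x₀`,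
written in integrated form. -/
def IsSolution (T : ℝ) (𝒜 : ℝ → Matrix (Fin N) (Fin N) ℝ) (B : Matrix (Fin N) (Fin q) ℝ)
    (x₀ : EuclideanSpace ℝ (Fin N)) (u : L2 T q) (x : ℝ → EuclideanSpace ℝ (Fin N)) : Prop :=
  ContinuousOn x (Set.Icc 0 T) ∧
    ∀ t ∈ Set.Icc 0 T,
      x t = x₀ + ∫ s in (0 : ℝ)..t, ((𝒜 s).toEuclideanLin (x s) + B.toEuclideanLin (u s))

/-- The solution of `x' = 𝒜(t) x + B u(t)`, `x(0) = x₀`; see `isSolution_state` and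
`IsSolution.eqOn` below for its existence and uniqueness on `[0,T]`. Its values off `[0,T]` are
never used. -/
noncomputable def state (T : ℝ) (𝒜 : ℝ → Matrix (Fin N) (Fin N) ℝ) (B : Matrix (Fin N) (Fin q) ℝ)
    (x₀ : EuclideanSpace ℝ (Fin N)) (u : L2 T q) : ℝ → EuclideanSpace ℝ (Fin N) :=
  Classical.epsilon (IsSolution T 𝒜 B x₀ u)

/-- The quadratic cost
`½ ∫₀ᵀ ((x - x_d)ᵀ Q (x - x_d) + uᵀ R u) dt` of the control `u`, where `x` solves
`x' = 𝒜(t) x + B u(t)`, `x(0) = x₀`. -/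
noncomputable def cost (T : ℝ) (𝒜 : ℝ → Matrix (Fin N) (Fin N) ℝ) (B : Matrix (Fin N) (Fin q) ℝ)
    (x₀ : EuclideanSpace ℝ (Fin N)) (Q : Matrix (Fin N) (Fin N) ℝ) (R : Matrix (Fin q) (Fin q) ℝ)
    (xd : L2 T N) (u : L2 T q) : ℝ :=
  (1 / 2) * ∫ t in (0 : ℝ)..T,
    (inner ℝ (state T 𝒜 B x₀ u t - xd t) (Q.toEuclideanLin (state T 𝒜 B x₀ u t - xd t))
      + inner ℝ (u t) (R.toEuclideanLin (u t)))

end Dynamics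

section Splitting

variable {N M : ℕ}

/-- `π_m`: the probability that `m` belongs to the selected subset, when the subset `S` of the
index set is selected with probability `p S`. -/
def inclusionProb (p : Finset (Fin M) → ℝ) (m : Fin M) : ℝ :=
  ∑ S with m ∈ S, p S

/-- `∑_{m ∈ S} A_m / π_m`. -/
noncomputable def selectedMatrix (Am : Fin M → Matrix (Fin N) (Fin N) ℝ) (p : Finset (Fin M) → ℝ)
    (S : Finset (Fin M)) : Matrix (Fin N) (Fin N) ℝ :=
  ∑ m ∈ S, (inclusionProb p m)⁻¹ • Am m

/-- `Var[𝒜] = ∑_S ‖∑_{m ∈ S} A_m / π_m - A‖² p_S`, with the Euclidean operator norm. -/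
noncomputable def splittingVar (A : Matrix (Fin N) (Fin N) ℝ)
    (Am : Fin M → Matrix (Fin N) (Fin N) ℝ) (p : Finset (Fin M) → ℝ) : ℝ :=
  ∑ S, ‖Matrix.toEuclideanCLM (𝕜 := ℝ) (selectedMatrix Am p S - A)‖ ^ 2 * p S

/-- The piecewise constant matrix `𝒜_h(ω, ·)`: it equals `∑_{m ∈ ω_k} A_m / π_m` on the `k`-th
interval `[t_{k-1}, t_k)` of the grid `τ`, and `0` off `[t_0, t_K)`. -/
noncomputable def randomMatrix (Am : Fin M → Matrix (Fin N) (Fin N) ℝ) (p : Finset (Fin M) → ℝ)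
    {K : ℕ} (τ : Fin (K + 1) → ℝ) (ω : Fin K → Finset (Fin M)) (t : ℝ) :
    Matrix (Fin N) (Fin N) ℝ :=
  ∑ k : Fin K, (Set.Ico (τ k.castSucc) (τ k.succ)).indicator
    (fun _ => selectedMatrix Am p (ω k)) t

/-- The grid spacing `h = max_k (t_k - t_{k-1})`. -/
noncomputable def gridSpacing {K : ℕ} (τ : Fin (K + 1) → ℝ) : ℝ :=
  ⨆ k : Fin K, (τ k.succ - τ k.castSucc)

/-- Expectation of `X` over the `K` independent selections, each with law `p`. -/
def expect {K : ℕ} (p : Finset (Fin M) → ℝ) (X : (Fin K → Finset (Fin M)) → ℝ) : ℝ :=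
  ∑ ω, X ω * ∏ k, p (ω k)

end Splitting

/-! Existence and uniqueness of the solution of the state equation. -/

section WellPosed

variable {E : Type*} [NormedAddCommGroup E] [NormedSpace ℝ E]

theorem integrableOn_rhs {T L : ℝ} {F : ℝ → E →L[ℝ] E} {g x : ℝ → E}
    (hF : AEStronglyMeasurable F (volume.restrict (Set.Ioc 0 T))) (hL : ∀ s, ‖F s‖ ≤ L)
    (hg : IntegrableOn g (Set.Ioc 0 T)) (hx : ContinuousOn x (Set.Icc 0 T)) :
    IntegrableOn (fun s => F s (x s) + g s) (Set.Ioc 0 T) := by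
  refine Integrable.add ?_ hg
  have hxi : IntegrableOn x (Set.Ioc 0 T) :=
    (hx.integrableOn_compact isCompact_Icc).mono_set Set.Ioc_subset_Icc_self
  refine Integrable.mono' (hxi.norm.const_mul L) 
    ((ContinuousLinearMap.id ℝ (E →L[ℝ] E)).aestronglyMeasurable_comp₂ hF hxi.1) (ae_of_all _ fun s => ?_)
  exact (F s).le_of_opNorm_le (hL s) _

/-- The integral operator whose fixed points are the solutions. -/
noncomputable def picardMap [CompleteSpace E] {T L : ℝ} (hT : 0 ≤ T) {F : ℝ → E →L[ℝ] E} {g : ℝ → E}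
    (hF : AEStronglyMeasurable F (volume.restrict (Set.Ioc 0 T))) (hL : ∀ s, ‖F s‖ ≤ L)
    (hg : IntegrableOn g (Set.Ioc 0 T)) (x₀ : E) (z : C(Set.Icc 0 T, E)) : C(Set.Icc 0 T, E) where
  toFun t := x₀ + ∫ s in (0 : ℝ)..t, (F s (Set.IccExtend hT z s) + g s)
  continuous_toFun := by
    refine continuous_const.add ?_
    have h := integrableOn_rhs hF hL hg (z.continuous.Icc_extend' (h := hT)).continuousOn
    have h2 : IntegrableOn (fun s => F s (Set.IccExtend hT z s) + g s) (Set.uIcc 0 T) := by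
      rw [Set.uIcc_of_le hT, integrableOn_Icc_iff_integrableOn_Ioc]; exact h
    have h3 := intervalIntegral.continuousOn_primitive_interval h2
    rw [Set.uIcc_of_le hT] at h3
    exact continuousOn_iff_continuous_domRestrict.mp h3

theorem picardMap_iterate_dist [CompleteSpace E] {T L : ℝ} (hT : 0 ≤ T) {F : ℝ → E →L[ℝ] E}
    {g : ℝ → E} (hF : AEStronglyMeasurable F (volume.restrict (Set.Ioc 0 T)))
    (hL : ∀ s, ‖F s‖ ≤ L) (hg : IntegrableOn g (Set.Ioc 0 T)) (x₀ : E)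
    (z w : C(Set.Icc 0 T, E)) (n : ℕ) (t : Set.Icc 0 T) :
    ‖(picardMap hT hF hL hg x₀)^[n] z t - (picardMap hT hF hL hg x₀)^[n] w t‖ ≤
      (L * t) ^ n / n.factorial * dist z w := by
  have hL0 : 0 ≤ L := (norm_nonneg _).trans (hL 0)
  induction n generalizing t with
  | zero => simpa [dist_eq_norm] using ContinuousMap.dist_apply_le_dist (f := z) (g := w) t
  | succ n ih =>
    rw [Function.iterate_succ_apply', Function.iterate_succ_apply']
    set z' := (picardMap hT hF hL hg x₀)^[n] z
    set w' := (picardMap hT hF hL hg x₀)^[n] w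
    have ht0 : (0 : ℝ) ≤ t := t.2.1
    have hint : ∀ y : C(Set.Icc 0 T, E), IntervalIntegrable
        (fun s => F s (Set.IccExtend hT y s) + g s) volume 0 t := fun y => by
      rw [intervalIntegrable_iff_integrableOn_Ioc_of_le ht0]
      exact (integrableOn_rhs hF hL hg
        (y.continuous.Icc_extend' (h := hT)).continuousOn).mono_set
          (Set.Ioc_subset_Ioc_right t.2.2)
    have heq : picardMap hT hF hL hg x₀ z' t - picardMap hT hF hL hg x₀ w' t =
        ∫ s in (0 : ℝ)..t, F s (Set.IccExtend hT z' s - Set.IccExtend hT w' s) := by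
      simp only [picardMap, ContinuousMap.coe_mk, add_sub_add_left_eq_sub]
      rw [← intervalIntegral.integral_sub (hint z') (hint w')]
      simp
    rw [heq]
    have hb : ∀ᵐ s ∂(volume : Measure ℝ), s ∈ Set.Ioc (0 : ℝ) t →
        ‖F s (Set.IccExtend hT z' s - Set.IccExtend hT w' s)‖ ≤
          (L ^ (n + 1) / n.factorial * dist z w) * s ^ n := by
      refine ae_of_all _ fun s hs => ?_
      have hs' : s ∈ Set.Icc 0 T := ⟨hs.1.le, hs.2.trans t.2.2⟩
      rw [Set.IccExtend_of_mem hT _ hs', Set.IccExtend_of_mem hT _ hs']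
      calc _ ≤ L * ((L * s) ^ n / n.factorial * dist z w) := by
            refine ((F s).le_of_opNorm_le (hL s) _).trans ?_
            exact mul_le_mul_of_nonneg_left (ih ⟨s, hs'⟩) hL0
        _ = _ := by rw [mul_pow]; ring
    refine (intervalIntegral.norm_integral_le_of_norm_le ht0 hb
      ((continuous_const.mul (continuous_pow n)).intervalIntegrable 0 t)).trans (le_of_eq ?_)
    rw [intervalIntegral.integral_const_mul, integral_pow, Nat.factorial_succ]
    push_cast
    have : (n.factorial : ℝ) ≠ 0 := by positivity
    field_simp
    ring

theorem exists_contracting [CompleteSpace E] {T L : ℝ} (hT : 0 ≤ T) {F : ℝ → E →L[ℝ] E}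
    {g : ℝ → E} (hF : AEStronglyMeasurable F (volume.restrict (Set.Ioc 0 T)))
    (hL : ∀ s, ‖F s‖ ≤ L) (hg : IntegrableOn g (Set.Ioc 0 T)) (x₀ : E) :
    ∃ n c, ContractingWith c (picardMap hT hF hL hg x₀)^[n] := by
  have hL0 : 0 ≤ L := (norm_nonneg _).trans (hL 0)
  obtain ⟨n, hn⟩ := (FloorSemiring.tendsto_pow_div_factorial_atTop (L * T)).eventually
    (gt_mem_nhds zero_lt_one) |>.exists
  have h0 : 0 ≤ (L * T) ^ n / n.factorial := by positivity
  refine ⟨n, ⟨_, h0⟩, hn, LipschitzWith.of_dist_le_mul fun z w => ?_⟩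
  refine (ContinuousMap.dist_le (mul_nonneg h0 dist_nonneg)).2 fun t => ?_
  rw [dist_eq_norm]
  refine (picardMap_iterate_dist hT hF hL hg x₀ z w n t).trans ?_
  have := t.2.1
  have := t.2.2
  refine mul_le_mul_of_nonneg_right ?_ dist_nonneg
  change _ ≤ (L * T) ^ n / n.factorial
  gcongr

theorem isFixedPt_of_solution [CompleteSpace E] {T L : ℝ} (hT : 0 ≤ T) {F : ℝ → E →L[ℝ] E}
    {g : ℝ → E} (hF : AEStronglyMeasurable F (volume.restrict (Set.Ioc 0 T)))
    (hL : ∀ s, ‖F s‖ ≤ L) (hg : IntegrableOn g (Set.Ioc 0 T)) (x₀ : E) {x : ℝ → E}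
    (hx : ContinuousOn x (Set.Icc 0 T))
    (hs : ∀ t ∈ Set.Icc 0 T, x t = x₀ + ∫ s in (0 : ℝ)..t, (F s (x s) + g s)) :
    Function.IsFixedPt (picardMap hT hF hL hg x₀) ⟨_, hx.domRestrict⟩ := by
  ext t
  simp only [picardMap, ContinuousMap.coe_mk, Set.domRestrict_apply]
  rw [hs t t.2]
  congr 1
  refine intervalIntegral.integral_congr fun s hs => ?_
  rw [Set.uIcc_of_le t.2.1] at hs
  have hs' : s ∈ Set.Icc 0 T := ⟨hs.1, hs.2.trans t.2.2⟩
  simp [Set.IccExtend_of_mem hT _ hs']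

end WellPosed

section

variable {N q : ℕ} {T : ℝ} {𝒜 : ℝ → Matrix (Fin N) (Fin N) ℝ}

theorem integrableOn_control (B : Matrix (Fin N) (Fin q) ℝ) (u : L2 T q) :
    IntegrableOn (fun s => B.toEuclideanLin (u s)) (Set.Ioc 0 T) :=
  (LinearMap.toContinuousLinearMap B.toEuclideanLin).integrable_comp
    ((Lp.memLp u).integrable (by norm_num))

/-- A bounded measurable system matrix has a solution, so `state` is one. -/
theorem isSolution_state (hT : 0 ≤ T) {L : ℝ}
    (hm : AEStronglyMeasurable (fun s => Matrix.toEuclideanCLM (𝕜 := ℝ) (𝒜 s))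
      (volume.restrict (Set.Ioc 0 T)))
    (hL : ∀ s, ‖Matrix.toEuclideanCLM (𝕜 := ℝ) (𝒜 s)‖ ≤ L) (B : Matrix (Fin N) (Fin q) ℝ)
    (x₀ : EuclideanSpace ℝ (Fin N)) (u : L2 T q) :
    IsSolution T 𝒜 B x₀ u (state T 𝒜 B x₀ u) := by
  refine Classical.epsilon_spec (p := IsSolution T 𝒜 B x₀ u) ?_
  obtain ⟨n, c, hc⟩ := exists_contracting hT hm hL (integrableOn_control B u) x₀
  have hfix := hc.isFixedPt_fixedPoint_iterate
  set z := ContractingWith.fixedPoint _ hc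
  refine ⟨Set.IccExtend hT z, (z.continuous.Icc_extend' (h := hT)).continuousOn, fun t ht => ?_⟩
  rw [Set.IccExtend_of_mem hT _ ht]
  conv_lhs => rw [← hfix]
  rfl

/-- The solution is unique on `[0,T]`. -/
theorem IsSolution.eqOn (hT : 0 ≤ T) {L : ℝ}
    (hm : AEStronglyMeasurable (fun s => Matrix.toEuclideanCLM (𝕜 := ℝ) (𝒜 s))
      (volume.restrict (Set.Ioc 0 T)))
    (hL : ∀ s, ‖Matrix.toEuclideanCLM (𝕜 := ℝ) (𝒜 s)‖ ≤ L) {B : Matrix (Fin N) (Fin q) ℝ}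
    {x₀ : EuclideanSpace ℝ (Fin N)} {u : L2 T q} {x y : ℝ → EuclideanSpace ℝ (Fin N)}
    (hx : IsSolution T 𝒜 B x₀ u x) (hy : IsSolution T 𝒜 B x₀ u y) :
    Set.EqOn x y (Set.Icc 0 T) := by
  obtain ⟨n, c, hc⟩ := exists_contracting hT hm hL (integrableOn_control B u) x₀
  have h := hc.fixedPoint_unique'
    ((isFixedPt_of_solution hT hm hL (integrableOn_control B u) x₀ hx.1 hx.2).iterate n)
    ((isFixedPt_of_solution hT hm hL (integrableOn_control B u) x₀ hy.1 hy.2).iterate n)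
  intro t ht
  exact congrArg (fun z : C(Set.Icc 0 T, EuclideanSpace ℝ (Fin N)) => z ⟨t, ht⟩) h

/-- The constant system matrix is covered. -/
theorem isSolution_state_const (hT : 0 ≤ T) (A : Matrix (Fin N) (Fin N) ℝ)
    (B : Matrix (Fin N) (Fin q) ℝ) (x₀ : EuclideanSpace ℝ (Fin N)) (u : L2 T q) :
    IsSolution T (fun _ => A) B x₀ u (state T (fun _ => A) B x₀ u) :=
  isSolution_state hT aestronglyMeasurable_const (fun _ => le_rfl) B x₀ u

theorem toEuclideanCLM_randomMatrix {M K : ℕ} (Am : Fin M → Matrix (Fin N) (Fin N) ℝ)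
    (p : Finset (Fin M) → ℝ) (τ : Fin (K + 1) → ℝ) (ω : Fin K → Finset (Fin M)) (s : ℝ) :
    Matrix.toEuclideanCLM (𝕜 := ℝ) (randomMatrix Am p τ ω s) =
      ∑ k : Fin K, (Set.Ico (τ k.castSucc) (τ k.succ)).indicator
        (fun _ => Matrix.toEuclideanCLM (𝕜 := ℝ) (selectedMatrix Am p (ω k))) s := by
  rw [randomMatrix, map_sum]
  refine Finset.sum_congr rfl fun k _ => ?_
  by_cases h : s ∈ Set.Ico (τ k.castSucc) (τ k.succ) <;> simp [h]

/-- The random system matrix is covered. -/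
theorem isSolution_state_randomMatrix (hT : 0 ≤ T) {M K : ℕ}
    (Am : Fin M → Matrix (Fin N) (Fin N) ℝ) (p : Finset (Fin M) → ℝ) (τ : Fin (K + 1) → ℝ)
    (ω : Fin K → Finset (Fin M)) (B : Matrix (Fin N) (Fin q) ℝ) (x₀ : EuclideanSpace ℝ (Fin N))
    (u : L2 T q) :
    IsSolution T (randomMatrix Am p τ ω) B x₀ u (state T (randomMatrix Am p τ ω) B x₀ u) := by
  refine isSolution_state hT
    (L := ∑ k, ‖Matrix.toEuclideanCLM (𝕜 := ℝ) (selectedMatrix Am p (ω k))‖) ?_ (fun s => ?_) B x₀ u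
  · simp_rw [toEuclideanCLM_randomMatrix]
    refine (Finset.stronglyMeasurable_fun_sum _ fun k _ => ?_).aestronglyMeasurable
    exact stronglyMeasurable_const.indicator measurableSet_Ico
  · rw [toEuclideanCLM_randomMatrix]
    exact (norm_sum_le _ _).trans (Finset.sum_le_sum fun k _ => norm_indicator_le_norm_self _ _)

end

end RandomSplitting

namespace RandomSplitting

/-! Both costs are quadratic, so comparing minimizers reduces to comparing first derivatives at one
fixed control. Write `u` for the minimizer of the full problem, `w ω` for that of the random one,
and `v = w ω - u`. The derivative of the full cost at `u` along `v` is nonnegative. That of the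
random cost is at most `-(α/2)‖v‖²`, either by `α`-convexity or, with `α = r`, because `R` is
bounded below by some `r > 0`. Hence `(α/2)‖v‖²` is at most the difference of the two derivatives at
`u`.

The control terms cancel in this difference, and an error in the states and an error in the
linearized states remain. The direction `v` depends on `ω`, so the linearized error cannot be
averaged as it stands. Duality (`integral_inner_adjoint`) rewrites it as the pairing of `B v` with
the difference of two adjoint states. Both are driven by the same deterministic misfit of the full
state, so only their systems differ. Young's inequality absorbs `‖v‖²` (`sq_mul_norm_sq_le`),
leaving two mean square errors between a randomized system and its mean.

Both are instances of `expect_norm_sq_sub_le`, one forward and one backward in time. Over one cell,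
dissipativity lets the squared error grow only through its pairing with `(G - A) x`. Freezing the
error at the left end of the cell makes the pairing average to zero, since that error depends on
other selections only and `G` has mean `A`. The increment of the error inside the cell produces a
term of order `h` times the variance. Summing over the cells and applying Grönwall's inequality
gives the rate.

The constant is independent of the splitting because dissipativity bounds every random state by the
data alone, and because only `‖A‖`, never `‖G‖`, enters the increment estimate. -/

/-- `x` is the primitive on `[a,b]` of the integrable function `f`. -/
structure IsPrimitiveOn {E : Type*} [NormedAddCommGroup E] [NormedSpace ℝ E]
    (x f : ℝ → E) (a b : ℝ) : Prop where
  le : a ≤ b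
  integrable : IntervalIntegrable f volume a b
  eq : ∀ t ∈ Set.Icc a b, x t = x a + ∫ s in a..t, f s

/-! ### Calculus of absolutely continuous curves in integral form. -/

namespace IsPrimitiveOn

section Basic

variable {E : Type*} [NormedAddCommGroup E] [NormedSpace ℝ E] {x y f g : ℝ → E} {a b c d T : ℝ}

theorem continuousOn (h : IsPrimitiveOn x f a b) : ContinuousOn x (Set.Icc a b) := by
  have h3 := intervalIntegral.continuousOn_primitive_interval' h.integrable Set.left_mem_uIcc
  rw [Set.uIcc_of_le h.le] at h3
  exact (continuousOn_const.add h3).congr h.eq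

theorem mono (h : IsPrimitiveOn x f a b) (hac : a ≤ c) (hcd : c ≤ d) (hdb : d ≤ b) :
    IsPrimitiveOn x f c d := by
  have hi : ∀ {r s}, a ≤ r → r ≤ s → s ≤ b → IntervalIntegrable f volume r s :=
    fun hr hrs hs => h.integrable.mono_set (by
      rw [Set.uIcc_of_le hrs, Set.uIcc_of_le h.le]; exact Set.Icc_subset_Icc hr hs)
  refine ⟨hcd, hi hac hcd hdb, fun t ht => ?_⟩
  rw [h.eq t ⟨hac.trans ht.1, ht.2.trans hdb⟩, h.eq c ⟨hac, hcd.trans hdb⟩, add_assoc,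
    intervalIntegral.integral_add_adjacent_intervals (hi le_rfl hac (hcd.trans hdb))
      (hi hac ht.1 (ht.2.trans hdb))]

theorem intervalIntegrable_of_mem (h : IsPrimitiveOn x f a b) {t : ℝ} (ht : t ∈ Set.Icc a b) :
    IntervalIntegrable f volume a t :=
  (h.mono le_rfl ht.1 ht.2).integrable

theorem add (hx : IsPrimitiveOn x f a b) (hy : IsPrimitiveOn y g a b) :
    IsPrimitiveOn (fun t => x t + y t) (fun t => f t + g t) a b := by
  refine ⟨hx.le, hx.integrable.add hy.integrable, fun t ht => ?_⟩
  rw [intervalIntegral.integral_add (hx.intervalIntegrable_of_mem ht)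
    (hy.intervalIntegrable_of_mem ht), hx.eq t ht, hy.eq t ht]
  abel

theorem const_smul (hx : IsPrimitiveOn x f a b) (r : ℝ) :
    IsPrimitiveOn (fun t => r • x t) (fun t => r • f t) a b := by
  refine ⟨hx.le, hx.integrable.smul r, fun t ht => ?_⟩
  rw [intervalIntegral.integral_smul, hx.eq t ht, smul_add]

theorem sub (hx : IsPrimitiveOn x f a b) (hy : IsPrimitiveOn y g a b) :
    IsPrimitiveOn (fun t => x t - y t) (fun t => f t - g t) a b := by
  refine ⟨hx.le, hx.integrable.sub hy.integrable, fun t ht => ?_⟩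
  rw [intervalIntegral.integral_sub (hx.intervalIntegrable_of_mem ht)
    (hy.intervalIntegrable_of_mem ht), hx.eq t ht, hy.eq t ht]
  abel

/-- The open interval suffices, so values of piecewise constant systems at grid points never matter.
-/
theorem congr (hx : IsPrimitiveOn x f a b) (hfg : ∀ᵐ s, s ∈ Set.Ioo a b → f s = g s) :
    IsPrimitiveOn x g a b := by
  have hae : ∀ t ≤ b, ∀ᵐ s, s ∈ Set.uIoc a t → a ≤ t → f s = g s := fun t ht => by
    have h₂ : ∀ᵐ s, s ≠ b := by simp [ae_iff, measure_singleton]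
    filter_upwards [h₂, hfg] with s hs2 h hs hat
    rw [Set.uIoc_of_le hat] at hs
    exact h ⟨hs.1, lt_of_le_of_ne (hs.2.trans ht) hs2⟩
  refine ⟨hx.le, hx.integrable.congr_ae ?_, fun t ht => ?_⟩
  · rw [Filter.EventuallyEq, ae_restrict_iff' measurableSet_uIoc]
    filter_upwards [hae b le_rfl] with s hs h using hs h hx.le
  · rw [hx.eq t ht]
    congr 1
    refine intervalIntegral.integral_congr_ae ?_
    filter_upwards [hae t ht.2] with s hs h using hs h ht.1

/-- Reversal of time. -/
theorem reverse (hx : IsPrimitiveOn x f 0 T) :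
    IsPrimitiveOn (fun t => x (T - t)) (fun t => -f (T - t)) 0 T := by
  refine ⟨hx.le, ?_, fun t ht => ?_⟩
  · have := (hx.integrable.comp_sub_left T).symm.neg
    simpa [Pi.neg_def] using this
  · have ht' : T - t ∈ Set.Icc 0 T := ⟨by linarith [ht.2], by linarith [ht.1]⟩
    have h1 := (hx.mono ht'.1 ht'.2 le_rfl).eq T ⟨ht'.2, le_rfl⟩
    rw [intervalIntegral.integral_neg, intervalIntegral.integral_comp_sub_left]
    simp only [sub_zero]
    rw [h1]
    abel

theorem map {F : Type*} [NormedAddCommGroup F] [NormedSpace ℝ F] [CompleteSpace E]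
    [CompleteSpace F] (hx : IsPrimitiveOn x f a b) (ℓ : E →L[ℝ] F) :
    IsPrimitiveOn (fun t => ℓ (x t)) (fun t => ℓ (f t)) a b := by
  refine ⟨hx.le, ⟨ℓ.integrable_comp hx.integrable.1, ℓ.integrable_comp hx.integrable.2⟩,
    fun t ht => ?_⟩
  rw [ℓ.intervalIntegral_comp_comm (hx.intervalIntegrable_of_mem ht), hx.eq t ht, map_add]

theorem norm_sub_le (hx : IsPrimitiveOn x f a b) {g : ℝ → ℝ} (hg : IntervalIntegrable g volume a b)
    (h : ∀ s ∈ Set.Ioc a b, ‖f s‖ ≤ g s) : ‖x b - x a‖ ≤ ∫ s in a..b, g s := by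
  rw [hx.eq b ⟨hx.le, le_rfl⟩, add_sub_cancel_left]
  exact intervalIntegral.norm_integral_le_of_norm_le hx.le (ae_of_all _ h) hg

end Basic

theorem mul_eq {x y f g : ℝ → ℝ} {a b : ℝ} (hx : IsPrimitiveOn x f a b)
    (hy : IsPrimitiveOn y g a b) :
    ∫ s in a..b, (f s * y s + x s * g s) = x b * y b - x a * y a := by
  have haa : a ∈ Set.uIcc a b := Set.left_mem_uIcc
  have hbb : b ∈ Set.Icc a b := ⟨hx.le, le_rfl⟩
  -- The curves are controlled on `[a,b]` only. Their primitives are defined on the whole line, so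
  -- they have honest derivatives almost everywhere, endpoints included, and obey the product rule
  -- for absolutely continuous functions.
  let X : ℝ → ℝ := fun t => x a + ∫ s in a..t, f s
  let Y : ℝ → ℝ := fun t => y a + ∫ s in a..t, g s
  have hconst : ∀ r : ℝ, AbsolutelyContinuousOnInterval (fun _ => r) a b := fun r =>
    (contDiffOn_const (n := 1)).absolutelyContinuousOnInterval
  have hX : AbsolutelyContinuousOnInterval X a b :=
    (hconst (x a)).add (hx.integrable.absolutelyContinuousOnInterval_intervalIntegral haa)
  have hY : AbsolutelyContinuousOnInterval Y a b :=
    (hconst (y a)).add (hy.integrable.absolutelyContinuousOnInterval_intervalIntegral haa)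
  have key := hX.integral_deriv_mul_eq_sub hY
  rw [hx.eq b hbb, hy.eq b hbb]
  have hXa : X a = x a := by simp [X]
  have hYa : Y a = y a := by simp [Y]
  rw [hXa, hYa] at key
  refine Eq.trans (intervalIntegral.integral_congr_ae ?_) key
  filter_upwards [hx.integrable.ae_hasDerivAt_integral, hy.integrable.ae_hasDerivAt_integral]
    with s h1 h2 hs
  have hs' := Set.uIoc_subset_uIcc hs
  have e1 : deriv X s = f s := ((h1 hs' a haa).const_add _).deriv
  have e2 : deriv Y s = g s := ((h2 hs' a haa).const_add _).deriv
  rw [Set.uIcc_of_le hx.le] at hs'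
  rw [e1, e2, hx.eq s hs', hy.eq s hs']

section Inner

variable {E : Type*} [NormedAddCommGroup E] [InnerProductSpace ℝ E] [FiniteDimensional ℝ E]
  {x y f g : ℝ → E} {a b : ℝ}

theorem intervalIntegrable_inner_left (hy : ContinuousOn y (Set.Icc a b)) (hab : a ≤ b)
    (hf : IntervalIntegrable f volume a b) :
    IntervalIntegrable (fun s => inner ℝ (f s) (y s)) volume a b := by
  rw [intervalIntegrable_iff_integrableOn_Icc_of_le hab] at hf ⊢
  obtain ⟨C, hC⟩ := isCompact_Icc.exists_bound_of_continuousOn hy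
  refine Integrable.mono' (hf.norm.const_mul C)
    (hf.aestronglyMeasurable.inner (hy.aestronglyMeasurable measurableSet_Icc)) ?_
  filter_upwards [ae_restrict_mem measurableSet_Icc] with s hs
  refine (norm_inner_le_norm _ _).trans ?_
  rw [mul_comm]
  exact mul_le_mul_of_nonneg_right (hC s hs) (norm_nonneg _)

theorem intervalIntegrable_inner_right (hy : ContinuousOn y (Set.Icc a b)) (hab : a ≤ b)
    (hf : IntervalIntegrable f volume a b) :
    IntervalIntegrable (fun s => inner ℝ (y s) (f s)) volume a b :=
  (intervalIntegrable_inner_left hy hab hf).congr fun _ _ => real_inner_comm _ _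

/-- Integration by parts. -/
theorem inner_eq (hx : IsPrimitiveOn x f a b) (hy : IsPrimitiveOn y g a b) :
    ∫ s in a..b, (inner ℝ (f s) (y s) + inner ℝ (x s) (g s)) =
      inner ℝ (x b) (y b) - inner ℝ (x a) (y a) := by
  let e := stdOrthonormalBasis ℝ E
  have hz : ∀ {z k : ℝ → E}, IsPrimitiveOn z k a b → ∀ i,
      IsPrimitiveOn (fun t => inner ℝ (e i) (z t)) (fun t => inner ℝ (e i) (k t)) a b :=
    fun h i => h.map (innerSL ℝ (e i))
  have hin : ∀ v w : E, inner ℝ v w = ∑ i, inner ℝ (e i) v * inner ℝ (e i) w := fun v w => by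
    rw [← e.sum_inner_mul_inner v w]
    exact Finset.sum_congr rfl fun i _ => by rw [real_inner_comm]
  rw [hin (x b), hin (x a), ← Finset.sum_sub_distrib]
  have hfun : (fun s => inner ℝ (f s) (y s) + inner ℝ (x s) (g s)) = fun s =>
      ∑ i, (inner ℝ (e i) (f s) * inner ℝ (e i) (y s) +
        inner ℝ (e i) (x s) * inner ℝ (e i) (g s)) := by
    funext s
    rw [hin (f s), hin (x s), ← Finset.sum_add_distrib]
  rw [hfun, intervalIntegral.integral_finsetSum]
  · exact Finset.sum_congr rfl fun i _ => (hz hx i).mul_eq (hz hy i)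
  · intro i _
    have h1 := (hz hx i)
    have h2 := (hz hy i)
    refine (h1.integrable.mul_continuousOn ?_).add (h2.integrable.continuousOn_mul ?_)
    · rw [Set.uIcc_of_le hx.le]; exact h2.continuousOn
    · rw [Set.uIcc_of_le hx.le]; exact h1.continuousOn

theorem norm_sq_eq (hx : IsPrimitiveOn x f a b) :
    ‖x b‖ ^ 2 = ‖x a‖ ^ 2 + 2 * ∫ s in a..b, inner ℝ (x s) (f s) := by
  have h := hx.inner_eq hx
  rw [real_inner_self_eq_norm_sq, real_inner_self_eq_norm_sq] at h
  rw [← intervalIntegral.integral_const_mul]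
  have : ∀ s, inner ℝ (f s) (x s) + inner ℝ (x s) (f s) = 2 * inner ℝ (x s) (f s) := fun s => by
    rw [real_inner_comm]; ring
  simp_rw [this] at h
  linarith

end Inner

end IsPrimitiveOn

/-! ### Stability of dissipative systems and the error over one cell. -/

section Dissipative

variable {E : Type*} [NormedAddCommGroup E] [InnerProductSpace ℝ E] [FiniteDimensional ℝ E]

/-- A dissipative linear system is stable with respect to its inhomogeneity. -/
theorem norm_le_of_dissipative {F : ℝ → E →L[ℝ] E} {x g : ℝ → E} {a b : ℝ}
    (hF : ∀ s v, inner ℝ v (F s v) ≤ 0)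
    (hx : IsPrimitiveOn x (fun s => F s (x s) + g s) a b) (hg : IntervalIntegrable g volume a b)
    {t : ℝ} (ht : t ∈ Set.Icc a b) : ‖x t‖ ≤ ‖x a‖ + 2 * ∫ s in a..b, ‖g s‖ := by
  -- At a maximum point of the norm the energy identity is bounded by a multiple of `‖x r‖`, which
  -- can then be divided out.
  obtain ⟨r, hr, hmax⟩ := isCompact_Icc.exists_isMaxOn ⟨t, ht⟩ hx.continuousOn.norm
  refine (hmax ht).trans ?_
  change ‖x r‖ ≤ _
  have hxr := hx.mono le_rfl hr.1 hr.2
  have hgr : IntervalIntegrable g volume a r := hg.mono_set (by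
    rw [Set.uIcc_of_le hr.1, Set.uIcc_of_le hx.le]; exact Set.Icc_subset_Icc le_rfl hr.2)
  have h1 := hxr.norm_sq_eq
  have h2 : ∫ s in a..r, inner ℝ (x s) (F s (x s) + g s) ≤ ∫ s in a..r, ‖x r‖ * ‖g s‖ := by
    refine intervalIntegral.integral_mono_on hr.1
      (IsPrimitiveOn.intervalIntegrable_inner_right hxr.continuousOn hr.1 hxr.integrable)
      (hgr.norm.const_mul _) fun s hs => ?_
    rw [inner_add_right]
    have h3 := real_inner_le_norm (x s) (g s)
    have h4 : ‖x s‖ * ‖g s‖ ≤ ‖x r‖ * ‖g s‖ :=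
      mul_le_mul_of_nonneg_right (hmax ⟨hs.1, hs.2.trans hr.2⟩) (norm_nonneg _)
    linarith [hF s (x s)]
  rw [intervalIntegral.integral_const_mul] at h2
  have h5 : ∫ s in a..r, ‖g s‖ ≤ ∫ s in a..b, ‖g s‖ :=
    intervalIntegral.integral_mono_interval le_rfl hr.1 hr.2
      (ae_of_all _ fun s => norm_nonneg (g s)) hg.norm
  have h6 : ‖x a‖ ≤ ‖x r‖ := hmax ⟨le_rfl, hx.le⟩
  rcases (norm_nonneg (x r)).eq_or_lt with h0 | h0
  · rw [← h0]
    have : 0 ≤ ∫ s in a..b, ‖g s‖ :=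
      intervalIntegral.integral_nonneg hx.le fun s _ => norm_nonneg (g s)
    positivity
  · have h7 : ‖x r‖ * ‖x r‖ ≤ ‖x r‖ * (‖x a‖ + 2 * ∫ s in a..b, ‖g s‖) := by
      nlinarith [norm_nonneg (x a)]
    exact le_of_mul_le_mul_left h7 h0

/-- The difference solves a dissipative system without source. Besides uniqueness, this yields
superposition of states and the fact that a state ignores selections that act only later. -/
theorem eq_of_dissipative {F F' : ℝ → E →L[ℝ] E} {x y g : ℝ → E} {a b : ℝ}
    (hF : ∀ s v, inner ℝ v (F s v) ≤ 0)
    (hx : IsPrimitiveOn x (fun s => F s (x s) + g s) a b)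
    (hy : IsPrimitiveOn y (fun s => F' s (y s) + g s) a b)
    (hFF : ∀ᵐ s, s ∈ Set.Ioo a b → F s = F' s) (hxy : x a = y a)
    {t : ℝ} (ht : t ∈ Set.Icc a b) : x t = y t := by
  have h : IsPrimitiveOn (fun t => x t - y t) (fun s => F s (x s - y s) + 0) a b := by
    refine (hx.sub hy).congr ?_
    filter_upwards [hFF] with s hs hs'
    rw [← hs hs', map_sub]
    abel
  have h2 := norm_le_of_dissipative hF h (by simp) ht
  simpa [hxy, sub_eq_zero] using h2

/-- Growth of the error between a dissipative system and another system over a short interval. -/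
theorem norm_sq_sub_le_of_dissipative {G A : E →L[ℝ] E} {x xh g : ℝ → E} {a b X h T : ℝ}
    (hG : ∀ v, inner ℝ v (G v) ≤ 0)
    (hx : IsPrimitiveOn x (fun s => A (x s) + g s) a b)
    (hxh : IsPrimitiveOn xh (fun s => G (xh s) + g s) a b)
    (hX : ∀ s ∈ Set.Icc a b, ‖x s‖ ≤ X) (hXh : ∀ s ∈ Set.Icc a b, ‖xh s‖ ≤ X)
    (hh : b - a ≤ h) (hT : b - a ≤ T) :
    ‖xh b - x b‖ ^ 2 ≤ ‖xh a - x a‖ ^ 2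
      + 2 * inner ℝ (xh a - x a) ((G - A) (∫ s in a..b, x s))
      + (2 + ‖A‖) * X ^ 2 * h * ‖G - A‖ ^ 2 * (b - a)
      + ‖A‖ * T * ∫ s in a..b, ‖xh s - x s‖ ^ 2 := by
  have hab := hx.le
  have hX0 : 0 ≤ X := (norm_nonneg _).trans (hX a ⟨le_rfl, hab⟩)
  have hA0 := norm_nonneg A
  have hD0 := norm_nonneg (G - A)
  have he := hxh.sub hx
  set e : ℝ → E := fun s => xh s - x s with he_def
  -- One derivative, split in two ways: `he1` bounds increments of `e` through `‖A‖` alone, while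
  -- `he2` exposes the dissipative term `G e` in the energy identity.
  have he1 : IsPrimitiveOn e (fun s => A (e s) + (G - A) (xh s)) a b :=
    he.congr (ae_of_all _ fun s _ => by simp [e])
  have he2 : IsPrimitiveOn e (fun s => G (e s) + (G - A) (x s)) a b :=
    he.congr (ae_of_all _ fun s _ => by simp [e])
  have hec := he.continuousOn
  have hei : ∀ {c d}, a ≤ c → c ≤ d → d ≤ b →
      IntervalIntegrable (fun s => ‖e s‖ ^ 2) volume c d := fun hc hcd hd =>
    ContinuousOn.intervalIntegrable (by
      rw [Set.uIcc_of_le hcd]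
      exact (hec.mono (Set.Icc_subset_Icc hc hd)).norm.pow 2)
  have hei1 : ∀ {c d}, a ≤ c → c ≤ d → d ≤ b →
      IntervalIntegrable (fun s => ‖e s‖) volume c d := fun hc hcd hd =>
    ContinuousOn.intervalIntegrable (by
      rw [Set.uIcc_of_le hcd]
      exact (hec.mono (Set.Icc_subset_Icc hc hd)).norm)
  have hxi : IntervalIntegrable x volume a b := ContinuousOn.intervalIntegrable (by
    rw [Set.uIcc_of_le hab]; exact hx.continuousOn)
  set I := ∫ s in a..b, ‖e s‖ ^ 2 with hI
  have hI0 : 0 ≤ I := intervalIntegral.integral_nonneg hab fun s _ => by positivity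
  -- The dissipative term is dropped and `e s` is replaced by `e a`. The increment `e s - e a` is
  -- estimated by `he1`, and Young's inequality separates `‖A‖ ‖e‖` from `‖G - A‖ X`.
  have hkey : ∀ s ∈ Set.Icc a b, inner ℝ (e s) (G (e s) + (G - A) (x s)) ≤
      inner ℝ (e a) ((G - A) (x s)) +
        ((1 + ‖A‖ / 2) * X ^ 2 * h * ‖G - A‖ ^ 2 + ‖A‖ / 2 * I) := by
    intro s hs
    have h1 := (he1.mono le_rfl hs.1 hs.2).norm_sub_le
      (g := fun r => ‖A‖ * ‖e r‖ + ‖G - A‖ * X)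
      (((hei1 le_rfl hs.1 hs.2).const_mul _).add intervalIntegrable_const) (fun r hr => by
        refine (norm_add_le _ _).trans (add_le_add (A.le_opNorm _)
          (((G - A).le_opNorm _).trans ?_))
        exact mul_le_mul_of_nonneg_left (hXh r ⟨hr.1.le, hr.2.trans hs.2⟩) hD0)
    have h2 : (∫ r in a..s, (‖A‖ * ‖e r‖ + ‖G - A‖ * X)) * (‖G - A‖ * X) ≤
        ∫ r in a..s, (‖A‖ / 2 * ‖e r‖ ^ 2 + (1 + ‖A‖ / 2) * X ^ 2 * ‖G - A‖ ^ 2) := by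
      rw [← intervalIntegral.integral_mul_const]
      refine intervalIntegral.integral_mono_on hs.1
        ((((hei1 le_rfl hs.1 hs.2).const_mul _).add intervalIntegrable_const).mul_const _)
        (((hei le_rfl hs.1 hs.2).const_mul _).add intervalIntegrable_const) fun r _ => ?_
      nlinarith [mul_nonneg hA0 (sq_nonneg (‖e r‖ - ‖G - A‖ * X))]
    rw [intervalIntegral.integral_add ((hei le_rfl hs.1 hs.2).const_mul _)
      intervalIntegrable_const, intervalIntegral.integral_const_mul,
      intervalIntegral.integral_const, smul_eq_mul] at h2
    have h3 : ∫ r in a..s, ‖e r‖ ^ 2 ≤ I :=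
      intervalIntegral.integral_mono_interval le_rfl hs.1 hs.2
        (ae_of_all _ fun s => sq_nonneg ‖e s‖) (hei le_rfl hab le_rfl)
    have h4 : (s - a) * ((1 + ‖A‖ / 2) * X ^ 2 * ‖G - A‖ ^ 2) ≤
        h * ((1 + ‖A‖ / 2) * X ^ 2 * ‖G - A‖ ^ 2) :=
      mul_le_mul_of_nonneg_right (by linarith [hs.2]) (by positivity)
    have h5 : inner ℝ (e s - e a) ((G - A) (x s)) ≤
        (∫ r in a..s, (‖A‖ * ‖e r‖ + ‖G - A‖ * X)) * (‖G - A‖ * X) := by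
      refine (real_inner_le_norm _ _).trans (mul_le_mul h1 ?_ (norm_nonneg _)
        ((norm_nonneg _).trans h1))
      exact ((G - A).le_opNorm _).trans (mul_le_mul_of_nonneg_left (hX s hs) hD0)
    have h6 : ‖A‖ / 2 * ∫ r in a..s, ‖e r‖ ^ 2 ≤ ‖A‖ / 2 * I :=
      mul_le_mul_of_nonneg_left h3 (by positivity)
    rw [inner_sub_left] at h5
    rw [inner_add_right]
    linarith [hG (e s)]
  have hDx : IntervalIntegrable (fun s => inner ℝ (e a) ((G - A) (x s))) volume a b :=
    IsPrimitiveOn.intervalIntegrable_inner_right continuousOn_const hab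
      ⟨(G - A).integrable_comp hxi.1, (G - A).integrable_comp hxi.2⟩
  have h7 := intervalIntegral.integral_mono_on hab
    (IsPrimitiveOn.intervalIntegrable_inner_right hec hab he2.integrable)
    (hDx.add intervalIntegrable_const) hkey
  rw [intervalIntegral.integral_add hDx intervalIntegrable_const,
    intervalIntegral.integral_const, smul_eq_mul] at h7
  have h8 : ∫ s in a..b, inner ℝ (e a) ((G - A) (x s)) =
      inner ℝ (e a) ((G - A) (∫ s in a..b, x s)) :=
    ((innerSL ℝ (e a)).comp (G - A)).intervalIntegral_comp_comm hxi
  rw [h8] at h7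
  have h9 := he2.norm_sq_eq
  have h10 : (b - a) * (‖A‖ * I) ≤ T * (‖A‖ * I) :=
    mul_le_mul_of_nonneg_right hT (by positivity)
  have e1 : ‖e b‖ ^ 2 = ‖xh b - x b‖ ^ 2 := rfl
  have e2 : e a = xh a - x a := rfl
  rw [← e1, ← e2]
  linarith

end Dissipative

/-- Grönwall's inequality in integral form. -/
theorem le_mul_exp_of_le_add_integral {y : ℝ → ℝ} {T c k : ℝ} (hT : 0 ≤ T) (hk : 0 ≤ k)
    (hy : ContinuousOn y (Set.Icc 0 T))
    (h : ∀ t ∈ Set.Icc 0 T, y t ≤ c + k * ∫ s in (0 : ℝ)..t, y s) {t : ℝ}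
    (ht : t ∈ Set.Icc 0 T) : y t ≤ c * Real.exp (k * t) := by
  -- A globally continuous extension makes the primitive differentiable everywhere. The differential
  -- Grönwall inequality applies to this primitive, and its bound is inserted into the hypothesis
  -- once more.
  let z : ℝ → ℝ := Set.IccExtend hT ((Set.Icc 0 T).domRestrict y)
  have hz : Continuous z := (continuousOn_iff_continuous_domRestrict.mp hy).Icc_extend'
  have hzy : ∀ s ∈ Set.Icc 0 T, z s = y s := fun s hs => Set.IccExtend_of_mem hT _ hs
  have hint : ∀ t ∈ Set.Icc 0 T, ∫ s in (0 : ℝ)..t, y s = ∫ s in (0 : ℝ)..t, z s := fun t ht =>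
    intervalIntegral.integral_congr fun s hs => by
      rw [Set.uIcc_of_le ht.1] at hs
      exact (hzy s ⟨hs.1, hs.2.trans ht.2⟩).symm
  have hd : ∀ s, HasDerivAt (fun t => ∫ s in (0 : ℝ)..t, z s) (z s) s := fun s =>
    intervalIntegral.integral_hasDerivAt_right (hz.intervalIntegrable 0 s)
      (hz.stronglyMeasurableAtFilter _ _) hz.continuousAt
  have hb : ∀ s ∈ Set.Icc 0 T, z s ≤ k * (∫ r in (0 : ℝ)..s, z r) + c := fun s hs => by
    have := h s hs
    rw [hint s hs, ← hzy s hs] at this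
    linarith
  have hw := le_gronwallBound_of_liminf_deriv_right_le (δ := 0) (K := k) (ε := c)
    (f := fun t => ∫ s in (0 : ℝ)..t, z s) (f' := z) (a := 0) (b := T)
    (fun s _ => (hd s).continuousAt.continuousWithinAt)
    (fun s _ r hr => (hd s).hasDerivWithinAt.liminf_right_slope_le hr) (by simp)
    (fun s hs => hb s ⟨hs.1, hs.2.le⟩) t ht
  have h1 := hb t ht
  rw [hzy t ht] at h1
  rcases eq_or_ne k 0 with rfl | hk0
  · simpa using h1
  · rw [gronwallBound_of_K_ne_0 hk0] at hw
    have h2 := mul_le_mul_of_nonneg_left hw hk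
    simp only [sub_zero, zero_mul, zero_add] at h2
    have h3 : k * (c / k * (Real.exp (k * t) - 1)) = c * Real.exp (k * t) - c := by
      field_simp
    linarith

/-! ### Finite product expectations. -/

section Expectation

variable {M K : ℕ} {p : Finset (Fin M) → ℝ} {X Y : (Fin K → Finset (Fin M)) → ℝ}

theorem expect_add : expect p (fun ω => X ω + Y ω) = expect p X + expect p Y := by
  simp [expect, add_mul, Finset.sum_add_distrib]

theorem expect_const_mul (c : ℝ) : expect p (fun ω => c * X ω) = c * expect p X := by
  simp [expect, Finset.mul_sum, mul_assoc]

theorem expect_const (hp1 : ∑ S, p S = 1) (c : ℝ) :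
    expect p (fun _ : Fin K → Finset (Fin M) => c) = c := by
  have h := Fintype.prod_sum fun (_ : Fin K) S => p S
  simp only [hp1, Finset.prod_const_one] at h
  rw [expect, ← Finset.mul_sum, ← h, mul_one]

theorem expect_mono (hp : ∀ S, 0 ≤ p S) (h : ∀ ω, X ω ≤ Y ω) : expect p X ≤ expect p Y :=
  Finset.sum_le_sum fun ω _ =>
    mul_le_mul_of_nonneg_right (h ω) (Finset.prod_nonneg fun k _ => hp (ω k))

/-- The law of the selections is invariant under resampling one of them. -/
theorem expect_resample (hp1 : ∑ S, p S = 1) (k : Fin K) :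
    expect p X = expect p (fun ω => ∑ S, X (Function.update ω k S) * p S) := by
  have hw : ∀ (ω : Fin K → Finset (Fin M)) S,
      (∏ j, p (Function.update ω k S j)) * p (ω k) = (∏ j, p (ω j)) * p S := fun ω S => by
    rw [← Finset.mul_prod_erase _ _ (Finset.mem_univ k),
      ← Finset.mul_prod_erase Finset.univ (fun j => p (ω j)) (Finset.mem_univ k),
      Function.update_self, Finset.prod_congr rfl (g := fun j => p (ω j)) fun j hj => by
        rw [Function.update_of_ne (Finset.ne_of_mem_erase hj)]]
    ring
  -- Exchanging `ω k` with an independent fresh sample is an involution, and by `hw` it preserves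
  -- the weight of the pair.
  let f : (Fin K → Finset (Fin M)) × Finset (Fin M) → (Fin K → Finset (Fin M)) × Finset (Fin M) :=
    fun z => (Function.update z.1 k z.2, z.1 k)
  have hf : Function.Involutive f := fun z => by simp [f]
  calc expect p X
      = ∑ z : (Fin K → Finset (Fin M)) × Finset (Fin M), X z.1 * ((∏ j, p (z.1 j)) * p z.2) := by
        rw [Fintype.sum_prod_type]
        refine Finset.sum_congr rfl fun ω _ => ?_
        simp only [← Finset.mul_sum, hp1, mul_one]
    _ = ∑ z, X (f z).1 * ((∏ j, p ((f z).1 j)) * p (f z).2) :=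
        (Equiv.sum_comp hf.toPerm _).symm
    _ = _ := by
        rw [Fintype.sum_prod_type, expect]
        refine Finset.sum_congr rfl fun ω _ => ?_
        rw [Finset.sum_mul]
        refine Finset.sum_congr rfl fun S _ => ?_
        simp only [f]
        rw [hw]
        ring

theorem expect_eval (hp1 : ∑ S, p S = 1) (k : Fin K) (Z : Finset (Fin M) → ℝ) :
    expect p (fun ω => Z (ω k)) = ∑ S, Z S * p S := by
  rw [expect_resample hp1 k]
  simp only [Function.update_self]
  exact expect_const hp1 _

/-- Since `V` ignores the `k`-th selection, averaging over that selection first leaves the pairing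
of `V` with the mean of `Z`. -/
theorem expect_inner_eq_zero {E : Type*} [NormedAddCommGroup E] [InnerProductSpace ℝ E]
    (hp1 : ∑ S, p S = 1) (k : Fin K) {V : (Fin K → Finset (Fin M)) → E} {Z : Finset (Fin M) → E}
    (hV : ∀ ω S, V (Function.update ω k S) = V ω) (hZ : ∑ S, p S • Z S = 0) :
    expect p (fun ω => inner ℝ (V ω) (Z (ω k))) = 0 := by
  rw [expect_resample hp1 k]
  have : ∀ ω, ∑ S, inner ℝ (V (Function.update ω k S)) (Z (Function.update ω k S k)) * p S = 0 :=
    fun ω => by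
      simp only [hV, Function.update_self]
      rw [← inner_zero_right (𝕜 := ℝ) (V ω), ← hZ, inner_sum]
      exact Finset.sum_congr rfl fun S _ => by rw [inner_smul_right, mul_comm]
  simp only [this]
  exact expect_const hp1 0

theorem integral_expect {y : (Fin K → Finset (Fin M)) → ℝ → ℝ} {a b : ℝ}
    (hy : ∀ ω, IntervalIntegrable (y ω) volume a b) :
    ∫ t in a..b, expect p (fun ω => y ω t) = expect p (fun ω => ∫ t in a..b, y ω t) := by
  simp only [expect]
  rw [intervalIntegral.integral_finsetSum fun ω _ => (hy ω).mul_const _]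
  simp only [intervalIntegral.integral_mul_const]

theorem continuousOn_expect {y : (Fin K → Finset (Fin M)) → ℝ → ℝ} {s : Set ℝ}
    (hy : ∀ ω, ContinuousOn (y ω) s) : ContinuousOn (fun t => expect p (fun ω => y ω t)) s :=
  continuousOn_finsetSum _ fun ω _ => (hy ω).mul continuousOn_const

end Expectation

/-! ### Mean square error of a randomized system. -/

section Error

variable {E : Type*} [NormedAddCommGroup E] [InnerProductSpace ℝ E] [FiniteDimensional ℝ E]

/-- Mean square error of a randomized dissipative system. The `k`-th cell of the grid uses the
selection with index `σ k`, so that the result applies forward and backward in time. -/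
theorem expect_norm_sq_sub_le {M K : ℕ} {p : Finset (Fin M) → ℝ} (hp : ∀ S, 0 ≤ p S)
    (hp1 : ∑ S, p S = 1) {G : Finset (Fin M) → E →L[ℝ] E} {A : E →L[ℝ] E}
    (hG : ∀ S v, inner ℝ v (G S v) ≤ 0) (hA : ∑ S, p S • (G S - A) = 0)
    {T h X : ℝ} {τ : Fin (K + 1) → ℝ} (hτ : StrictMono τ) (hτ0 : τ 0 = 0)
    (hτT : τ (Fin.last K) = T) (hh : ∀ k : Fin K, τ k.succ - τ k.castSucc ≤ h) (hh0 : 0 ≤ h)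
    (σ : Equiv.Perm (Fin K)) {F : (Fin K → Finset (Fin M)) → ℝ → E →L[ℝ] E}
    (hFd : ∀ ω s v, inner ℝ v (F ω s v) ≤ 0)
    (hF : ∀ ω k, ∀ s ∈ Set.Ioo (τ k.castSucc) (τ k.succ), F ω s = G (ω (σ k)))
    {x g : ℝ → E} {xh : (Fin K → Finset (Fin M)) → ℝ → E}
    (hx : IsPrimitiveOn x (fun s => A (x s) + g s) 0 T)
    (hxh : ∀ ω, IsPrimitiveOn (xh ω) (fun s => F ω s (xh ω s) + g s) 0 T)
    (h0 : ∀ ω, xh ω 0 = x 0) (hX : ∀ s ∈ Set.Icc 0 T, ‖x s‖ ≤ X)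
    (hXh : ∀ ω, ∀ s ∈ Set.Icc 0 T, ‖xh ω s‖ ≤ X) {t : ℝ} (ht : t ∈ Set.Icc 0 T) :
    expect p (fun ω => ‖xh ω t - x t‖ ^ 2) ≤
      (2 + ‖A‖) * X ^ 2 * h * (∑ S, ‖G S - A‖ ^ 2 * p S) * T * Real.exp (‖A‖ * T * T) := by
  have hT : 0 ≤ T := hx.le
  set V := ∑ S, ‖G S - A‖ ^ 2 * p S
  have hV0 : 0 ≤ V := Finset.sum_nonneg fun S _ => mul_nonneg (sq_nonneg _) (hp S)
  have hA0 := norm_nonneg A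
  set c := (2 + ‖A‖) * X ^ 2 * h * V
  have hc0 : 0 ≤ c := by positivity
  let y : ℝ → ℝ := fun t => expect p (fun ω => ‖xh ω t - x t‖ ^ 2)
  have hpath : ∀ ω, ContinuousOn (fun t => ‖xh ω t - x t‖ ^ 2) (Set.Icc 0 T) := fun ω =>
    ((hxh ω).sub hx).continuousOn.norm.pow 2
  have hyc : ContinuousOn y (Set.Icc 0 T) := continuousOn_expect hpath
  have hyi : ∀ {a b}, 0 ≤ a → a ≤ b → b ≤ T → IntervalIntegrable y volume a b :=
    fun ha hab hb => ContinuousOn.intervalIntegrable (by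
      rw [Set.uIcc_of_le hab]; exact hyc.mono (Set.Icc_subset_Icc ha hb))
  have hτmem : ∀ k, 0 ≤ τ k ∧ τ k ≤ T := fun k =>
    ⟨hτ0 ▸ hτ.monotone (Fin.zero_le k), hτT ▸ hτ.monotone (Fin.le_last k)⟩
  have hgrid : ∀ᵐ s : ℝ, ∀ k, s ≠ τ k :=
    ae_all_iff.2 fun k => by simp [ae_iff, measure_singleton]
  -- Resampling the selection of cell `k` changes the system on that cell only, so the solution up
  -- to its left end is unaffected.
  have hadapt : ∀ k ω S, xh (Function.update ω (σ k) S) (τ k.castSucc) = xh ω (τ k.castSucc) := by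
    intro k ω S
    have hk := hτmem k.castSucc
    refine eq_of_dissipative (hFd _) ((hxh _).mono le_rfl hk.1 hk.2)
      ((hxh ω).mono le_rfl hk.1 hk.2) ?_ ((h0 _).trans (h0 ω).symm) ⟨hk.1, le_rfl⟩
    filter_upwards [hgrid] with s hs hsk
    have hex : ∃ j : Fin K, s ∈ Set.Ioo (τ j.castSucc) (τ j.succ) := by
      by_contra! hno
      have : ∀ i : Fin (K + 1), τ i < s := by
        intro i
        induction i using Fin.induction with
        | zero => rw [hτ0]; exact hsk.1
        | succ j ih =>
          by_contra! hle
          exact hno j ⟨ih, lt_of_le_of_ne hle (hs _)⟩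
      exact (this k.castSucc).not_gt hsk.2
    obtain ⟨j, hj⟩ := hex
    have hjk : j ≠ k := by
      rintro rfl
      exact hj.1.not_gt hsk.2
    rw [hF _ j s hj, hF _ j s hj, Function.update_of_ne (σ.injective.ne hjk)]
  -- The expected one-cell estimate: by `hadapt` and unbiasedness the frozen pairing has mean zero.
  -- It holds at every `b` in the cell, so Grönwall's inequality can be used in continuous time.
  have hstep : ∀ (k : Fin K), ∀ b ∈ Set.Icc (τ k.castSucc) (τ k.succ),
      y b ≤ y (τ k.castSucc) + c * (b - τ k.castSucc) +
        ‖A‖ * T * ∫ s in (τ k.castSucc)..b, y s := by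
    intro k b hb
    set a := τ k.castSucc with ha
    have ha0 : 0 ≤ a := (hτmem _).1
    have hbT : b ≤ T := hb.2.trans (hτmem _).2
    have hsub : Set.Icc a b ⊆ Set.Icc 0 T := Set.Icc_subset_Icc ha0 hbT
    have h1 : ∀ ω, ‖xh ω b - x b‖ ^ 2 ≤ ‖xh ω a - x a‖ ^ 2
        + 2 * inner ℝ (xh ω a - x a) ((G (ω (σ k)) - A) (∫ s in a..b, x s))
        + (2 + ‖A‖) * X ^ 2 * h * (b - a) * ‖G (ω (σ k)) - A‖ ^ 2
        + ‖A‖ * T * ∫ s in a..b, ‖xh ω s - x s‖ ^ 2 := fun ω => by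
      have h2 : IsPrimitiveOn (xh ω) (fun s => G (ω (σ k)) (xh ω s) + g s) a b :=
        ((hxh ω).mono ha0 hb.1 hbT).congr (ae_of_all _ fun s hs => by
          rw [hF ω k s ⟨hs.1, hs.2.trans_le hb.2⟩])
      have h3 := norm_sq_sub_le_of_dissipative (hG _) (hx.mono ha0 hb.1 hbT) h2
        (fun s hs => hX s (hsub hs)) (fun s hs => hXh ω s (hsub hs))
        (h := h) (T := T) (by linarith [hh k, hb.2]) (by linarith)
      linarith
    have h4 := expect_mono hp h1
    rw [expect_add, expect_add, expect_add, expect_const_mul, expect_const_mul, expect_const_mul,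
      expect_eval hp1 (σ k) (fun S => ‖G S - A‖ ^ 2),
      expect_inner_eq_zero hp1 (σ k) (V := fun ω => xh ω a - x a)
        (Z := fun S => (G S - A) (∫ s in a..b, x s)) (fun ω S => by rw [hadapt])
        (by
          have := congrArg (fun L : E →L[ℝ] E => L (∫ s in a..b, x s)) hA
          simpa using this),
      ← integral_expect fun ω => ContinuousOn.intervalIntegrable (by
        rw [Set.uIcc_of_le hb.1]; exact (hpath ω).mono hsub)] at h4
    change y b ≤ y a + 2 * 0 + (2 + ‖A‖) * X ^ 2 * h * (b - a) * V
      + ‖A‖ * T * ∫ s in a..b, y s at h4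
    have : (2 + ‖A‖) * X ^ 2 * h * (b - a) * V = c * (b - a) := by simp only [c]; ring
    linarith
  have hy0 : y 0 = 0 := by
    simp only [y, h0, sub_self, norm_zero]
    simpa using expect_const (K := K) hp1 0
  have hall : ∀ k : Fin (K + 1), ∀ s ∈ Set.Icc 0 (τ k),
      y s ≤ c * s + ‖A‖ * T * ∫ r in (0 : ℝ)..s, y r := by
    intro k
    induction k using Fin.induction with
    | zero =>
      intro s hs
      rw [hτ0] at hs
      obtain rfl : s = 0 := le_antisymm hs.2 hs.1
      simp [hy0]
    | succ k ih =>
      intro s hs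
      have hk := hτmem k.castSucc
      rcases le_total s (τ k.castSucc) with hle | hle
      · exact ih s ⟨hs.1, hle⟩
      · have h1 := ih _ ⟨hk.1, le_rfl⟩
        have h2 := hstep k s ⟨hle, hs.2⟩
        rw [← intervalIntegral.integral_add_adjacent_intervals (hyi le_rfl hk.1 hk.2)
          (hyi hk.1 hle (hs.2.trans (hτmem _).2))]
        linarith
  have hgron := le_mul_exp_of_le_add_integral (c := c * T) (k := ‖A‖ * T) hT (by positivity) hyc
    (fun s hs => (hall (Fin.last K) s (by rwa [hτT])).trans (by
      have := mul_le_mul_of_nonneg_left hs.2 hc0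
      linarith)) ht
  refine hgron.trans (mul_le_mul_of_nonneg_left (Real.exp_le_exp.2 ?_) (by positivity))
  exact mul_le_mul_of_nonneg_left ht.2 (by positivity)

end Error

/-! ### Time-dependent dissipative systems and duality. -/

section System

variable {E : Type*} [NormedAddCommGroup E] [InnerProductSpace ℝ E] [FiniteDimensional ℝ E]

/-- A bounded measurable time-dependent dissipative operator. -/
structure IsDissipativeSystem (F : ℝ → E →L[ℝ] E) : Prop where
  stronglyMeasurable : StronglyMeasurable F
  bounded : ∃ L, ∀ s, ‖F s‖ ≤ L
  inner_le : ∀ s v, inner ℝ v (F s v) ≤ 0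

namespace IsDissipativeSystem

variable {F : ℝ → E →L[ℝ] E}

/-- The system of the adjoint equation, in reversed time. -/
theorem adjointReverse (hF : IsDissipativeSystem F) (T : ℝ) :
    IsDissipativeSystem (fun s => ContinuousLinearMap.adjoint (F (T - s))) where
  stronglyMeasurable := ContinuousLinearMap.adjoint.continuous.comp_stronglyMeasurable
    (hF.stronglyMeasurable.comp_measurable (measurable_const.sub measurable_id))
  bounded := by
    obtain ⟨L, hL⟩ := hF.bounded
    exact ⟨L, fun s => by rw [LinearIsometryEquiv.norm_map]; exact hL _⟩
  inner_le s v := by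
    rw [ContinuousLinearMap.adjoint_inner_right, real_inner_comm]
    exact hF.inner_le _ v

/-- Supplies the adjoint states, whose source is a state misfit and not of the form `B u` handled by
`state`. -/
theorem exists_isPrimitiveOn (hF : IsDissipativeSystem F) {T : ℝ} (hT : 0 ≤ T) {g : ℝ → E}
    (hg : IntervalIntegrable g volume 0 T) (x₀ : E) :
    ∃ x, x 0 = x₀ ∧ IsPrimitiveOn x (fun s => F s (x s) + g s) 0 T := by
  obtain ⟨L, hL⟩ := hF.bounded
  have hm := hF.stronglyMeasurable.aestronglyMeasurable (μ := volume.restrict (Set.Ioc 0 T))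
  rw [intervalIntegrable_iff_integrableOn_Ioc_of_le hT] at hg
  obtain ⟨n, c, hc⟩ := exists_contracting hT hm hL hg x₀
  have hfix := hc.isFixedPt_fixedPoint_iterate
  set z := ContractingWith.fixedPoint _ hc
  have hz : ∀ t ∈ Set.Icc 0 T, Set.IccExtend hT z t =
      x₀ + ∫ s in (0 : ℝ)..t, (F s (Set.IccExtend hT z s) + g s) := fun t ht => by
    rw [Set.IccExtend_of_mem hT _ ht]
    conv_lhs => rw [← hfix]
    rfl
  have h0 : Set.IccExtend hT z 0 = x₀ := by simpa using hz 0 ⟨le_rfl, hT⟩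
  refine ⟨Set.IccExtend hT z, h0, hT, ?_, fun t ht => by rw [h0]; exact hz t ht⟩
  rw [intervalIntegrable_iff_integrableOn_Ioc_of_le hT]
  exact integrableOn_rhs hm hL hg (z.continuous.Icc_extend' (h := hT)).continuousOn

end IsDissipativeSystem

/-- Duality between a linear system and its adjoint. -/
theorem integral_inner_adjoint {F : ℝ → E →L[ℝ] E} {y ψ g b : ℝ → E} {T : ℝ}
    (hy : IsPrimitiveOn y (fun s => F s (y s) + b s) 0 T) (hy0 : y 0 = 0)
    (hψ : IsPrimitiveOn ψ
      (fun s => ContinuousLinearMap.adjoint (F (T - s)) (ψ s) + g (T - s)) 0 T) (hψ0 : ψ 0 = 0)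
    (hg : IntervalIntegrable g volume 0 T) (hb : IntervalIntegrable b volume 0 T) :
    ∫ s in (0 : ℝ)..T, inner ℝ (g s) (y s) = ∫ s in (0 : ℝ)..T, inner ℝ (ψ (T - s)) (b s) := by
  -- The curve `ψ (T - s)` solves the backward adjoint equation. Integrating its pairing with `y` by
  -- parts, the terms with `F` cancel and both boundary terms vanish.
  have h := hψ.reverse.inner_eq hy
  simp only [sub_self, hψ0, hy0, inner_zero_left, inner_zero_right] at h
  have h1 := IsPrimitiveOn.intervalIntegrable_inner_left hy.continuousOn hy.le hg
  have h2 := IsPrimitiveOn.intervalIntegrable_inner_right hψ.reverse.continuousOn hy.le hb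
  rw [← sub_eq_zero, ← neg_eq_zero, neg_sub, ← intervalIntegral.integral_sub h2 h1]
  refine (intervalIntegral.integral_congr fun s _ => ?_).trans h
  simp only [sub_sub_cancel, inner_neg_left, inner_add_left, inner_add_right,
    ContinuousLinearMap.adjoint_inner_left]
  ring

end System

/-! ### Square integrable functions on `(0,T]`. -/

section SquareIntegrable

variable {Ω E : Type*} [MeasurableSpace Ω] {μ : Measure Ω} [NormedAddCommGroup E]

theorem integrable_inner_of_memLp [InnerProductSpace ℝ E] {f g : Ω → E} (hf : MemLp f 2 μ) (hg : MemLp g 2 μ) :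
    Integrable (fun s => inner ℝ (f s) (g s)) μ := by
  refine (L2.integrable_inner (𝕜 := ℝ) (hf.toLp f) (hg.toLp g)).congr ?_
  filter_upwards [hf.coeFn_toLp, hg.coeFn_toLp] with s h1 h2
  rw [h1, h2]

theorem memLp_of_continuousOn_Icc {f : ℝ → E} {T : ℝ} (hf : ContinuousOn f (Set.Icc 0 T)) :
    MemLp f 2 (volume.restrict (Set.Ioc 0 T)) := by
  obtain ⟨C, hC⟩ := isCompact_Icc.exists_bound_of_continuousOn hf
  refine MemLp.of_bound ((hf.mono Set.Ioc_subset_Icc_self).aestronglyMeasurable measurableSet_Ioc)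
    C ?_
  filter_upwards [ae_restrict_mem measurableSet_Ioc] with s hs
  exact hC s (Set.Ioc_subset_Icc_self hs)

theorem integral_norm_sq_eq {T : ℝ} (hT : 0 ≤ T) {n : ℕ} (v : L2 T n) :
    ∫ s in (0 : ℝ)..T, ‖v s‖ ^ 2 = ‖v‖ ^ 2 := by
  rw [← real_inner_self_eq_norm_sq, L2.inner_def, intervalIntegral.integral_of_le hT]
  simp only [real_inner_self_eq_norm_sq]

theorem sq_integral_le {T : ℝ} (hT : 0 < T) {f : ℝ → ℝ} (hf : IntervalIntegrable f volume 0 T)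
    (hf2 : IntervalIntegrable (fun s => f s ^ 2) volume 0 T) :
    (∫ s in (0 : ℝ)..T, f s) ^ 2 ≤ T * ∫ s in (0 : ℝ)..T, f s ^ 2 := by
  set I := ∫ s in (0 : ℝ)..T, f s with hI
  -- The integrated variance of `f` around its mean, scaled by `T ^ 2` to avoid division.
  have h0 : 0 ≤ ∫ s in (0 : ℝ)..T, (T * f s - I) ^ 2 :=
    intervalIntegral.integral_nonneg hT.le fun s _ => sq_nonneg _
  have h1 : ∀ s, (T * f s - I) ^ 2 = T ^ 2 * f s ^ 2 + (-2 * T * I) * f s + I ^ 2 := fun s => by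
    ring
  simp only [h1] at h0
  rw [intervalIntegral.integral_add ((hf2.const_mul _).add (hf.const_mul _))
    intervalIntegrable_const, intervalIntegral.integral_add (hf2.const_mul _) (hf.const_mul _),
    intervalIntegral.integral_const_mul, intervalIntegral.integral_const_mul, ← hI,
    intervalIntegral.integral_const, smul_eq_mul] at h0
  have h2 : 0 ≤ T * (T * (∫ s in (0 : ℝ)..T, f s ^ 2) - I ^ 2) := by linarith
  linarith [nonneg_of_mul_nonneg_right h2 hT]

end SquareIntegrable

/-! ### Quadratic expansion of the cost and first-order conditions. -/

section Cost

variable {N q : ℕ} {T : ℝ} {𝒜 : ℝ → Matrix (Fin N) (Fin N) ℝ} {B : Matrix (Fin N) (Fin q) ℝ}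
  {x₀ : EuclideanSpace ℝ (Fin N)} {Q : Matrix (Fin N) (Fin N) ℝ} {R : Matrix (Fin q) (Fin q) ℝ}
  {xd : L2 T N} {u v : L2 T q}

theorem intervalIntegrable_control (hT : 0 ≤ T) (B : Matrix (Fin N) (Fin q) ℝ) (u : L2 T q) :
    IntervalIntegrable (fun s => B.toEuclideanLin (u s)) volume 0 T := by
  rw [intervalIntegrable_iff_integrableOn_Ioc_of_le hT]
  exact integrableOn_control B u

theorem isPrimitiveOn_state (hT : 0 ≤ T)
    (h𝒜 : IsDissipativeSystem fun s => Matrix.toEuclideanCLM (𝕜 := ℝ) (𝒜 s))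
    (B : Matrix (Fin N) (Fin q) ℝ) (x₀ : EuclideanSpace ℝ (Fin N)) (u : L2 T q) :
    IsPrimitiveOn (state T 𝒜 B x₀ u)
      (fun s => Matrix.toEuclideanCLM (𝕜 := ℝ) (𝒜 s) (state T 𝒜 B x₀ u s) +
        B.toEuclideanLin (u s)) 0 T ∧ state T 𝒜 B x₀ u 0 = x₀ := by
  obtain ⟨L, hL⟩ := h𝒜.bounded
  have hm := h𝒜.stronglyMeasurable.aestronglyMeasurable (μ := volume.restrict (Set.Ioc 0 T))
  have hs := isSolution_state hT hm hL B x₀ u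
  have h0 : state T 𝒜 B x₀ u 0 = x₀ := by simpa using hs.2 0 ⟨le_rfl, hT⟩
  refine ⟨⟨hT, ?_, fun t ht => by rw [h0]; exact hs.2 t ht⟩, h0⟩
  rw [intervalIntegrable_iff_integrableOn_Ioc_of_le hT]
  exact integrableOn_rhs hm hL (integrableOn_control B u) hs.1

theorem state_add_smul (hT : 0 ≤ T)
    (h𝒜 : IsDissipativeSystem fun s => Matrix.toEuclideanCLM (𝕜 := ℝ) (𝒜 s)) (θ : ℝ)
    {t : ℝ} (ht : t ∈ Set.Icc 0 T) :
    state T 𝒜 B x₀ (u + θ • v) t = state T 𝒜 B x₀ u t + θ • state T 𝒜 B 0 v t := by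
  obtain ⟨h1, h10⟩ := isPrimitiveOn_state hT h𝒜 B x₀ (u + θ • v)
  obtain ⟨h2, h20⟩ := isPrimitiveOn_state hT h𝒜 B x₀ u
  obtain ⟨h3, h30⟩ := isPrimitiveOn_state hT h𝒜 B 0 v
  refine eq_of_dissipative (g := fun s => B.toEuclideanLin ((u + θ • v : L2 T q) s))
    h𝒜.inner_le h1 ((h2.add (h3.const_smul θ)).congr ?_) (ae_of_all _ fun _ _ => rfl)
    (by rw [h10, h20, h30, smul_zero, add_zero]) ht
  have hae := (Lp.coeFn_add u (θ • v)).and (Lp.coeFn_smul θ v)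
  rw [ae_restrict_iff' measurableSet_Ioc] at hae
  filter_upwards [hae] with s hs hs'
  obtain ⟨e1, e2⟩ := hs ⟨hs'.1, hs'.2.le⟩
  rw [e1, Pi.add_apply, e2, Pi.smul_apply, map_add, map_add, map_smul, map_smul, smul_add]
  abel

/-- The directional derivative of the cost. -/
noncomputable def costDeriv (T : ℝ) (𝒜 : ℝ → Matrix (Fin N) (Fin N) ℝ)
    (B : Matrix (Fin N) (Fin q) ℝ) (x₀ : EuclideanSpace ℝ (Fin N)) (Q : Matrix (Fin N) (Fin N) ℝ)
    (R : Matrix (Fin q) (Fin q) ℝ) (xd : L2 T N) (u v : L2 T q) : ℝ :=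
  (∫ t in (0 : ℝ)..T, inner ℝ (Q.toEuclideanLin (state T 𝒜 B x₀ u t - xd t)) (state T 𝒜 B 0 v t))
    + ∫ t in (0 : ℝ)..T, inner ℝ (u t) (R.toEuclideanLin (v t))

/-- The second directional derivative of the cost. -/
noncomputable def costHess (T : ℝ) (𝒜 : ℝ → Matrix (Fin N) (Fin N) ℝ)
    (B : Matrix (Fin N) (Fin q) ℝ) (Q : Matrix (Fin N) (Fin N) ℝ)
    (R : Matrix (Fin q) (Fin q) ℝ) (v : L2 T q) : ℝ :=
  (∫ t in (0 : ℝ)..T, inner ℝ (state T 𝒜 B 0 v t) (Q.toEuclideanLin (state T 𝒜 B 0 v t)))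
    + ∫ t in (0 : ℝ)..T, inner ℝ (v t) (R.toEuclideanLin (v t))

theorem intervalIntegrable_inner_toEuclideanLin (hT : 0 ≤ T) {m n : ℕ}
    (D : Matrix (Fin m) (Fin n) ℝ) {f : ℝ → EuclideanSpace ℝ (Fin m)}
    {g : ℝ → EuclideanSpace ℝ (Fin n)} (hf : MemLp f 2 (volume.restrict (Set.Ioc 0 T)))
    (hg : MemLp g 2 (volume.restrict (Set.Ioc 0 T))) :
    IntervalIntegrable (fun s => inner ℝ (f s) (D.toEuclideanLin (g s))) volume 0 T := by
  rw [intervalIntegrable_iff_integrableOn_Ioc_of_le hT]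
  exact integrable_inner_of_memLp hf
    ((LinearMap.toContinuousLinearMap D.toEuclideanLin).comp_memLp' hg)

theorem memLp_state (hT : 0 ≤ T)
    (h𝒜 : IsDissipativeSystem fun s => Matrix.toEuclideanCLM (𝕜 := ℝ) (𝒜 s))
    (B : Matrix (Fin N) (Fin q) ℝ) (x₀ : EuclideanSpace ℝ (Fin N)) (u : L2 T q) :
    MemLp (state T 𝒜 B x₀ u) 2 (volume.restrict (Set.Ioc 0 T)) :=
  memLp_of_continuousOn_Icc (isPrimitiveOn_state hT h𝒜 B x₀ u).1.continuousOn

/-- The state is affine in the control, so the second-order expansion is exact; symmetry of `Q` and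
`R` merges the cross terms. -/
theorem cost_add_smul (hT : 0 ≤ T)
    (h𝒜 : IsDissipativeSystem fun s => Matrix.toEuclideanCLM (𝕜 := ℝ) (𝒜 s))
    (hQ : Q.toEuclideanLin.IsSymmetric) (hR : R.toEuclideanLin.IsSymmetric) (θ : ℝ) :
    cost T 𝒜 B x₀ Q R xd (u + θ • v) = cost T 𝒜 B x₀ Q R xd u
      + θ * costDeriv T 𝒜 B x₀ Q R xd u v + θ ^ 2 / 2 * costHess T 𝒜 B Q R v := by
  have hP := (memLp_state hT h𝒜 B x₀ u).sub (Lp.memLp xd)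
  have hY := memLp_state hT h𝒜 B 0 v
  have hu := Lp.memLp u
  have hv := Lp.memLp v
  have i1 := intervalIntegrable_inner_toEuclideanLin hT Q hP hP
  have i2 := intervalIntegrable_inner_toEuclideanLin hT Q hP hY
  have i3 := intervalIntegrable_inner_toEuclideanLin hT Q hY hY
  have i4 := intervalIntegrable_inner_toEuclideanLin hT R hu hu
  have i5 := intervalIntegrable_inner_toEuclideanLin hT R hu hv
  have i6 := intervalIntegrable_inner_toEuclideanLin hT R hv hv
  simp only [Pi.sub_apply] at i1 i2
  have key : ∫ t in (0 : ℝ)..T,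
      (inner ℝ (state T 𝒜 B x₀ (u + θ • v) t - xd t)
        (Q.toEuclideanLin (state T 𝒜 B x₀ (u + θ • v) t - xd t))
        + inner ℝ ((u + θ • v : L2 T q) t) (R.toEuclideanLin ((u + θ • v : L2 T q) t))) =
      ∫ t in (0 : ℝ)..T,
        ((inner ℝ (state T 𝒜 B x₀ u t - xd t) (Q.toEuclideanLin (state T 𝒜 B x₀ u t - xd t))
          + inner ℝ (u t) (R.toEuclideanLin (u t)))
        + ((2 * θ) * (inner ℝ (state T 𝒜 B x₀ u t - xd t) (Q.toEuclideanLin (state T 𝒜 B 0 v t))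
          + inner ℝ (u t) (R.toEuclideanLin (v t)))
        + θ ^ 2 * (inner ℝ (state T 𝒜 B 0 v t) (Q.toEuclideanLin (state T 𝒜 B 0 v t))
          + inner ℝ (v t) (R.toEuclideanLin (v t))))) := by
    have hae := (Lp.coeFn_add u (θ • v)).and (Lp.coeFn_smul θ v)
    rw [ae_restrict_iff' measurableSet_Ioc] at hae
    refine intervalIntegral.integral_congr_ae ?_
    filter_upwards [hae] with t ht ht'
    rw [Set.uIoc_of_le hT] at ht'
    obtain ⟨e1, e2⟩ := ht ht'
    rw [state_add_smul hT h𝒜 θ (Set.Ioc_subset_Icc_self ht'), e1, Pi.add_apply, e2, Pi.smul_apply,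
      add_sub_right_comm]
    generalize state T 𝒜 B x₀ u t - xd t = a
    generalize state T 𝒜 B 0 v t = b
    have s1 : inner ℝ b (Q.toEuclideanLin a) = inner ℝ a (Q.toEuclideanLin b) := by
      rw [← hQ, real_inner_comm]
    have s2 : inner ℝ (v t) (R.toEuclideanLin (u t)) = inner ℝ (u t) (R.toEuclideanLin (v t)) := by
      rw [← hR, real_inner_comm]
    simp only [map_add, map_smul, inner_add_left, inner_add_right, inner_smul_left,
      inner_smul_right, s1, s2, conj_trivial]
    ring
  have hswap : ∀ t, inner ℝ (Q.toEuclideanLin (state T 𝒜 B x₀ u t - xd t)) (state T 𝒜 B 0 v t) =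
      inner ℝ (state T 𝒜 B x₀ u t - xd t) (Q.toEuclideanLin (state T 𝒜 B 0 v t)) :=
    fun t => hQ _ _
  simp only [cost, costDeriv, costHess, hswap]
  rw [key, intervalIntegral.integral_add (i1.add i4)
      (((i2.add i5).const_mul _).add ((i3.add i6).const_mul _)),
    intervalIntegral.integral_add ((i2.add i5).const_mul _) ((i3.add i6).const_mul _),
    intervalIntegral.integral_const_mul, intervalIntegral.integral_const_mul,
    intervalIntegral.integral_add i2 i5, intervalIntegral.integral_add i3 i6]
  ring

theorem le_costHess (hT : 0 ≤ T)
    (hQ : ∀ z, 0 ≤ inner ℝ z (Q.toEuclideanLin z)) {r : ℝ}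
    (hR : ∀ z, r * ‖z‖ ^ 2 ≤ inner ℝ z (R.toEuclideanLin z)) (v : L2 T q) :
    r * ‖v‖ ^ 2 ≤ costHess T 𝒜 B Q R v := by
  have hv := Lp.memLp v
  have h1 : 0 ≤ ∫ t in (0 : ℝ)..T,
      inner ℝ (state T 𝒜 B 0 v t) (Q.toEuclideanLin (state T 𝒜 B 0 v t)) :=
    intervalIntegral.integral_nonneg hT fun s _ => hQ _
  have h2 : ∫ t in (0 : ℝ)..T, r * ‖v t‖ ^ 2 ≤
      ∫ t in (0 : ℝ)..T, inner ℝ (v t) (R.toEuclideanLin (v t)) := by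
    refine intervalIntegral.integral_mono_on hT ?_
      (intervalIntegrable_inner_toEuclideanLin hT R hv hv) fun s _ => hR _
    rw [intervalIntegrable_iff_integrableOn_Ioc_of_le hT]
    refine Integrable.const_mul ?_ r
    simpa only [real_inner_self_eq_norm_sq] using integrable_inner_of_memLp hv hv
  rw [intervalIntegral.integral_const_mul, integral_norm_sq_eq hT] at h2
  rw [costHess]
  linarith

/-- The quadratic form attains a positive minimum on the compact unit sphere, and homogeneity does
the rest. For `q = 0` the sphere is empty and any constant serves. -/
theorem exists_coercive (hR : R.PosDef) :
    ∃ r > 0, ∀ z, r * ‖z‖ ^ 2 ≤ inner ℝ z (R.toEuclideanLin z) := by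
  have hpos : ∀ z : EuclideanSpace ℝ (Fin q), z ≠ 0 → 0 < inner ℝ z (R.toEuclideanLin z) :=
    fun z hz => by
      have h := hR.dotProduct_mulVec_pos (x := z.ofLp) (by simpa using hz)
      rw [EuclideanSpace.inner_eq_star_dotProduct, dotProduct_comm]
      exact h
  have hc : Continuous fun z : EuclideanSpace ℝ (Fin q) => inner ℝ z (R.toEuclideanLin z) :=
    continuous_id.inner (LinearMap.continuous_of_finiteDimensional _)
  rcases (Metric.sphere (0 : EuclideanSpace ℝ (Fin q)) 1).eq_empty_or_nonempty with he | hne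
  · refine ⟨1, one_pos, fun z => ?_⟩
    have hz : z = 0 := by
      by_contra hz
      have : ‖z‖⁻¹ • z ∈ Metric.sphere (0 : EuclideanSpace ℝ (Fin q)) 1 := by
        simp [norm_smul, hz]
      simp [he] at this
    simp [hz]
  · obtain ⟨w, hw, hmin⟩ := (isCompact_sphere (0 : EuclideanSpace ℝ (Fin q)) 1).exists_isMinOn hne
      hc.continuousOn
    refine ⟨_, hpos w (by rintro rfl; simp at hw), fun z => ?_⟩
    rcases eq_or_ne z 0 with rfl | hz
    · simp
    · have hz' : ‖z‖ ≠ 0 := norm_ne_zero_iff.2 hz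
      have := hmin (a := ‖z‖⁻¹ • z) (by simp [norm_smul, hz])
      simp only [Set.mem_ofPred_eq, map_smul, inner_smul_left, inner_smul_right,
        conj_trivial] at this
      calc _ ≤ (‖z‖⁻¹ * (‖z‖⁻¹ * inner ℝ z (R.toEuclideanLin z))) * ‖z‖ ^ 2 :=
            mul_le_mul_of_nonneg_right this (sq_nonneg _)
        _ = _ := by field_simp

/-- At a minimizer the cost has nonnegative directional derivatives. -/
theorem costDeriv_nonneg (hT : 0 ≤ T)
    (h𝒜 : IsDissipativeSystem fun s => Matrix.toEuclideanCLM (𝕜 := ℝ) (𝒜 s))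
    (hQ : Q.toEuclideanLin.IsSymmetric) (hR : R.toEuclideanLin.IsSymmetric)
    (hu : IsMinOn (cost T 𝒜 B x₀ Q R xd) Set.univ u) (v : L2 T q) :
    0 ≤ costDeriv T 𝒜 B x₀ Q R xd u v := by
  by_contra! hD
  set D := costDeriv T 𝒜 B x₀ Q R xd u v
  set H := costHess T 𝒜 B Q R v
  have h1 : ∀ θ : ℝ, 0 < θ → 0 ≤ D + θ / 2 * H := fun θ hθ => by
    have h := hu (Set.mem_univ (u + θ • v))
    simp only [Set.mem_ofPred_eq] at h
    rw [cost_add_smul hT h𝒜 hQ hR] at h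
    have h2 : 0 ≤ θ * (D + θ / 2 * H) := by linarith
    exact nonneg_of_mul_nonneg_right h2 hθ
  have hpos : 0 < |H| + 1 := by positivity
  -- With this step length the quadratic term can undo at most half of `D`.
  have h2 := h1 (-D / (|H| + 1)) (div_pos (neg_pos.2 hD) hpos)
  have h3 : -D / (|H| + 1) * (|H| + 1) = -D := div_mul_cancel₀ _ hpos.ne'
  have h4 : 0 < -D / (|H| + 1) := div_pos (neg_pos.2 hD) hpos
  nlinarith [le_abs_self H]

/-- The exact expansion from `u` to `w` and minimality of `w` put the derivative below minus half
the second derivative, which coercivity bounds. -/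
theorem costDeriv_le_of_coercive (hT : 0 ≤ T)
    (h𝒜 : IsDissipativeSystem fun s => Matrix.toEuclideanCLM (𝕜 := ℝ) (𝒜 s))
    (hQ : Q.toEuclideanLin.IsSymmetric) (hR : R.toEuclideanLin.IsSymmetric)
    (hQ0 : ∀ z, 0 ≤ inner ℝ z (Q.toEuclideanLin z)) {r : ℝ}
    (hr : ∀ z, r * ‖z‖ ^ 2 ≤ inner ℝ z (R.toEuclideanLin z)) {w : L2 T q}
    (hw : IsMinOn (cost T 𝒜 B x₀ Q R xd) Set.univ w) (u : L2 T q) :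
    costDeriv T 𝒜 B x₀ Q R xd u (w - u) ≤ -(r / 2 * ‖w - u‖ ^ 2) := by
  have h := hw (Set.mem_univ u)
  simp only [Set.mem_ofPred_eq] at h
  have h1 := cost_add_smul (x₀ := x₀) (xd := xd) (B := B) (u := u) (v := w - u) hT h𝒜 hQ hR 1
  rw [one_smul, add_sub_cancel] at h1
  linarith [le_costHess (𝒜 := 𝒜) (B := B) hT hQ0 hr (w - u)]

theorem costDeriv_le_of_strongConvexOn (hT : 0 ≤ T)
    (h𝒜 : IsDissipativeSystem fun s => Matrix.toEuclideanCLM (𝕜 := ℝ) (𝒜 s))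
    (hQ : Q.toEuclideanLin.IsSymmetric) (hR : R.toEuclideanLin.IsSymmetric)
    (hQ0 : ∀ z, 0 ≤ inner ℝ z (Q.toEuclideanLin z)) (hR0 : ∀ z, 0 ≤ inner ℝ z (R.toEuclideanLin z))
    {α : ℝ} (hα : StrongConvexOn Set.univ α (cost T 𝒜 B x₀ Q R xd)) {w : L2 T q}
    (hw : IsMinOn (cost T 𝒜 B x₀ Q R xd) Set.univ w) (u : L2 T q) :
    costDeriv T 𝒜 B x₀ Q R xd u (w - u) ≤ -(α / 2 * ‖w - u‖ ^ 2) := by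
  have h := hw (Set.mem_univ u)
  simp only [Set.mem_ofPred_eq] at h
  set D := costDeriv T 𝒜 B x₀ Q R xd u (w - u)
  set n := ‖w - u‖ ^ 2
  have hH := le_costHess (𝒜 := 𝒜) (B := B) (r := 0) hT hQ0 (by simpa using hR0) (w - u)
  rw [zero_mul] at hH
  -- Strong convexity on the segment from `u` to `w`, after discarding the nonnegative second-order
  -- term and dividing by `θ`. The claim is the limit `θ → 0`.
  have h1 : ∀ θ : ℝ, 0 < θ → θ < 1 → D ≤ -(α / 2 * n) + θ * (α / 2 * n) := fun θ h0 h1 => by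
    have h2 := hα.2 (Set.mem_univ u) (Set.mem_univ w) (sub_nonneg.2 h1.le) h0.le (by ring)
    have h3 : (1 - θ) • u + θ • w = u + θ • (w - u) := by
      rw [sub_smul, one_smul, smul_sub]; abel
    rw [h3, cost_add_smul hT h𝒜 hQ hR, norm_sub_rev] at h2
    simp only [smul_eq_mul] at h2
    have h4 : θ * cost T 𝒜 B x₀ Q R xd w ≤ θ * cost T 𝒜 B x₀ Q R xd u :=
      mul_le_mul_of_nonneg_left h h0.le
    have h5 : 0 ≤ θ ^ 2 / 2 * costHess T 𝒜 B Q R (w - u) := by positivity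
    have h6 : θ * D ≤ θ * (-(α / 2 * n) + θ * (α / 2 * n)) := by
      simp only [D, n]
      linarith
    exact le_of_mul_le_mul_left h6 h0
  refine le_of_forall_pos_le_add fun ε hε => ?_
  have hpos : 0 < |α / 2 * n| + ε := by positivity
  obtain ⟨θ, h0, h2⟩ := exists_between (lt_min one_pos (div_pos hε hpos))
  have h3 := h1 θ h0 (h2.trans_le (min_le_left _ _))
  have h4 : θ * (|α / 2 * n| + ε) ≤ ε := by
    rw [← le_div_iff₀ hpos]
    exact (h2.trans_le (min_le_right _ _)).le
  have h5 : θ * (α / 2 * n) ≤ θ * (|α / 2 * n| + ε) :=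
    mul_le_mul_of_nonneg_left (by linarith [le_abs_self (α / 2 * n)]) h0.le
  linarith

end Cost

/-! ### Comparison of the two minimizers for a fixed realization. -/

section Comparison

variable {N q : ℕ} {T : ℝ} {A : Matrix (Fin N) (Fin N) ℝ} {𝒜 : ℝ → Matrix (Fin N) (Fin N) ℝ}
  {B : Matrix (Fin N) (Fin q) ℝ}
  {x₀ : EuclideanSpace ℝ (Fin N)} {Q : Matrix (Fin N) (Fin N) ℝ} {R : Matrix (Fin q) (Fin q) ℝ}
  {xd : L2 T N} {u v : L2 T q}

theorem intervalIntegrable_source (hT : 0 ≤ T)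
    (h𝒜 : IsDissipativeSystem fun s => Matrix.toEuclideanCLM (𝕜 := ℝ) (𝒜 s))
    (B : Matrix (Fin N) (Fin q) ℝ) (x₀ : EuclideanSpace ℝ (Fin N)) (Q : Matrix (Fin N) (Fin N) ℝ)
    (xd : L2 T N) (u : L2 T q) :
    IntervalIntegrable (fun s => Q.toEuclideanLin (state T 𝒜 B x₀ u s - xd s)) volume 0 T := by
  rw [intervalIntegrable_iff_integrableOn_Ioc_of_le hT]
  exact ((LinearMap.toContinuousLinearMap Q.toEuclideanLin).comp_memLp'
    ((memLp_state hT h𝒜 B x₀ u).sub (Lp.memLp xd))).integrable (by norm_num)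

/-- The distance of the minimizers is controlled by the errors in the states and the adjoints. -/
theorem sq_mul_norm_sq_le (hT : 0 < T)
    (hA : IsDissipativeSystem fun _ => Matrix.toEuclideanCLM (𝕜 := ℝ) A)
    (h𝒜 : IsDissipativeSystem fun s => Matrix.toEuclideanCLM (𝕜 := ℝ) (𝒜 s))
    {α b c : ℝ} (hα : 0 < α) (hb : 0 < b) (hB : ∀ z, ‖B.toEuclideanLin z‖ ≤ b * ‖z‖)
    (hQc : ∀ z, ‖Q.toEuclideanLin z‖ ≤ c * ‖z‖)
    (h1 : 0 ≤ costDeriv T (fun _ => A) B x₀ Q R xd u v)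
    (h2 : costDeriv T 𝒜 B x₀ Q R xd u v ≤ -(α / 2 * ‖v‖ ^ 2))
    {ψ ψh : ℝ → EuclideanSpace ℝ (Fin N)} (hψ0 : ψ 0 = 0) (hψh0 : ψh 0 = 0)
    (hψ : IsPrimitiveOn ψ (fun s => ContinuousLinearMap.adjoint
      (Matrix.toEuclideanCLM (𝕜 := ℝ) A) (ψ s) +
        Q.toEuclideanLin (state T (fun _ => A) B x₀ u (T - s) - xd (T - s))) 0 T)
    (hψh : IsPrimitiveOn ψh (fun s => ContinuousLinearMap.adjoint
      (Matrix.toEuclideanCLM (𝕜 := ℝ) (𝒜 (T - s))) (ψh s) +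
        Q.toEuclideanLin (state T (fun _ => A) B x₀ u (T - s) - xd (T - s))) 0 T) :
    α ^ 2 * ‖v‖ ^ 2 ≤ 8 * b ^ 2 * (∫ s in (0 : ℝ)..T, ‖ψh s - ψ s‖ ^ 2) +
      32 * c ^ 2 * b ^ 2 * T ^ 2 *
        ∫ s in (0 : ℝ)..T, ‖state T 𝒜 B x₀ u s - state T (fun _ => A) B x₀ u s‖ ^ 2 := by
  have hx := (isPrimitiveOn_state hT.le hA B x₀ u).1
  have hxh := (isPrimitiveOn_state hT.le h𝒜 B x₀ u).1
  obtain ⟨hy, hy0⟩ := isPrimitiveOn_state hT.le hA B 0 v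
  obtain ⟨hyh, hyh0⟩ := isPrimitiveOn_state hT.le h𝒜 B 0 v
  have hg := intervalIntegrable_source hT.le hA B x₀ Q xd u
  have hgh := intervalIntegrable_source hT.le h𝒜 B x₀ Q xd u
  have hBv := intervalIntegrable_control hT.le B v
  -- Both pairings use the misfit of the unperturbed state as source, even for the perturbed system.
  -- The two adjoints then differ only through their systems.
  have d1 := integral_inner_adjoint hy hy0 hψ hψ0 hg hBv
  have d2 := integral_inner_adjoint hyh hyh0 hψh hψh0 hg hBv
  have hc2 : ∀ {z : ℝ → EuclideanSpace ℝ (Fin N)}, ContinuousOn z (Set.Icc 0 T) →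
      IntervalIntegrable (fun s => ‖z s‖ ^ 2) volume 0 T := fun hz =>
    ContinuousOn.intervalIntegrable (by rw [Set.uIcc_of_le hT.le]; exact hz.norm.pow 2)
  have hφ := hψ.reverse.continuousOn
  have hφh := hψh.reverse.continuousOn
  have hv1 : IntervalIntegrable (fun s => ‖v s‖) volume 0 T := by
    rw [intervalIntegrable_iff_integrableOn_Ioc_of_le hT.le]
    exact ((Lp.memLp v).integrable (by norm_num)).norm
  have hv2 : IntervalIntegrable (fun s => ‖v s‖ ^ 2) volume 0 T := by
    rw [intervalIntegrable_iff_integrableOn_Ioc_of_le hT.le]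
    have := integrable_inner_of_memLp (Lp.memLp v) (Lp.memLp v)
    simp only [real_inner_self_eq_norm_sq] at this
    exact this
  have hI := sq_integral_le hT hv1 hv2
  rw [integral_norm_sq_eq hT.le] at hI
  set I := ∫ s in (0 : ℝ)..T, ‖v s‖
  have hI0 : 0 ≤ I := intervalIntegral.integral_nonneg hT.le fun s _ => norm_nonneg _
  have hyb : ∀ s ∈ Set.Icc 0 T, ‖state T 𝒜 B 0 v s‖ ≤ 2 * b * I := fun s hs => by
    have h := norm_le_of_dissipative h𝒜.inner_le hyh hBv hs
    rw [hyh0, norm_zero, zero_add] at h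
    have h3 : ∫ s in (0 : ℝ)..T, ‖B.toEuclideanLin (v s)‖ ≤ ∫ s in (0 : ℝ)..T, b * ‖v s‖ :=
      intervalIntegral.integral_mono_on hT.le hBv.norm (hv1.const_mul _) fun s _ => hB _
    rw [intervalIntegral.integral_const_mul] at h3
    linarith
  have e1 := IsPrimitiveOn.intervalIntegrable_inner_right hφ hT.le hBv
  have e2 := IsPrimitiveOn.intervalIntegrable_inner_right hφh hT.le hBv
  have e3 := IsPrimitiveOn.intervalIntegrable_inner_left hyh.continuousOn hT.le hg
  have e4 := IsPrimitiveOn.intervalIntegrable_inner_left hyh.continuousOn hT.le hgh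
  -- Subtracting `h2` from `h1` cancels the terms with `R`. The pairing of the unperturbed misfit
  -- with the perturbed linearized state is added and subtracted.
  have hdiff : α / 2 * ‖v‖ ^ 2 ≤ ∫ s in (0 : ℝ)..T,
      ((inner ℝ (ψ (T - s)) (B.toEuclideanLin (v s)) -
        inner ℝ (ψh (T - s)) (B.toEuclideanLin (v s))) +
      (inner ℝ (Q.toEuclideanLin (state T (fun _ => A) B x₀ u s - xd s)) (state T 𝒜 B 0 v s) -
        inner ℝ (Q.toEuclideanLin (state T 𝒜 B x₀ u s - xd s)) (state T 𝒜 B 0 v s))) := by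
    rw [intervalIntegral.integral_add (e1.sub e2) (e3.sub e4),
      intervalIntegral.integral_sub e1 e2, intervalIntegral.integral_sub e3 e4, ← d1, ← d2]
    simp only [costDeriv] at h1 h2
    linarith
  have f1 := hc2 (hφh.sub hφ)
  have f2 := hc2 (hxh.continuousOn.sub hx.continuousOn)
  simp only [Pi.sub_apply] at f1 f2
  -- Young's inequality is weighted so that each of the two errors costs `α / 8 * ‖v‖ ^ 2` after
  -- integration, half of the left-hand side in total. For the second, `I ^ 2` is bounded by `T *
  -- ‖v‖ ^ 2`.
  have hmono := intervalIntegral.integral_mono_on hT.le ((e1.sub e2).add (e3.sub e4))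
    ((((f1.const_mul (2 * b ^ 2 / α)).add (hv2.const_mul (α / 8))).add
      (f2.const_mul (8 * T ^ 2 * b ^ 2 * c ^ 2 / α))).add
      (intervalIntegrable_const (c := α / (8 * T ^ 2) * I ^ 2))) fun s hs => by
    have g1 : inner ℝ (ψ (T - s)) (B.toEuclideanLin (v s)) -
        inner ℝ (ψh (T - s)) (B.toEuclideanLin (v s)) ≤
        2 * b ^ 2 / α * ‖ψh (T - s) - ψ (T - s)‖ ^ 2 + α / 8 * ‖v s‖ ^ 2 := by
      rw [← inner_sub_left]
      refine (real_inner_le_norm _ _).trans ?_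
      rw [norm_sub_rev]
      refine (mul_le_mul_of_nonneg_left (hB _) (norm_nonneg _)).trans ?_
      have := mul_nonneg (div_pos (by norm_num : (0 : ℝ) < 1) (mul_pos (by norm_num : (0 : ℝ) < 8)
        hα)).le (sq_nonneg (4 * b * ‖ψh (T - s) - ψ (T - s)‖ - α * ‖v s‖))
      have h3 : 1 / (8 * α) * (4 * b * ‖ψh (T - s) - ψ (T - s)‖ - α * ‖v s‖) ^ 2 =
          2 * b ^ 2 / α * ‖ψh (T - s) - ψ (T - s)‖ ^ 2 + α / 8 * ‖v s‖ ^ 2 -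
          ‖ψh (T - s) - ψ (T - s)‖ * (b * ‖v s‖) := by
        field_simp
        ring
      linarith
    have g2 : inner ℝ (Q.toEuclideanLin (state T (fun _ => A) B x₀ u s - xd s))
          (state T 𝒜 B 0 v s) -
        inner ℝ (Q.toEuclideanLin (state T 𝒜 B x₀ u s - xd s)) (state T 𝒜 B 0 v s) ≤
        8 * T ^ 2 * b ^ 2 * c ^ 2 / α *
          ‖state T 𝒜 B x₀ u s - state T (fun _ => A) B x₀ u s‖ ^ 2 +
          α / (8 * T ^ 2) * I ^ 2 := by
      rw [← inner_sub_left, ← map_sub, sub_sub_sub_cancel_right]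
      refine (real_inner_le_norm _ _).trans ?_
      have h3 := hQc (state T (fun _ => A) B x₀ u s - state T 𝒜 B x₀ u s)
      rw [norm_sub_rev] at h3
      refine (mul_le_mul h3 (hyb s hs) (norm_nonneg _) ((norm_nonneg _).trans h3)).trans ?_
      set d := ‖state T 𝒜 B x₀ u s - state T (fun _ => A) B x₀ u s‖
      have := mul_nonneg (div_pos (by norm_num : (0 : ℝ) < 1)
        (mul_pos (by norm_num : (0 : ℝ) < 8) (mul_pos hα (pow_pos hT 2)))).le
        (sq_nonneg (8 * T ^ 2 * b * c * d - α * I))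
      have h4 : 1 / (8 * (α * T ^ 2)) * (8 * T ^ 2 * b * c * d - α * I) ^ 2 =
          8 * T ^ 2 * b ^ 2 * c ^ 2 / α * d ^ 2 + α / (8 * T ^ 2) * I ^ 2 -
            c * d * (2 * b * I) := by
        field_simp
        ring
      linarith
    linarith
  have hrev : ∫ s in (0 : ℝ)..T, ‖ψh (T - s) - ψ (T - s)‖ ^ 2 =
      ∫ s in (0 : ℝ)..T, ‖ψh s - ψ s‖ ^ 2 := by
    have := intervalIntegral.integral_comp_sub_left (a := 0) (b := T)
      (fun s => ‖ψh s - ψ s‖ ^ 2) T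
    simpa using this
  rw [intervalIntegral.integral_add (((f1.const_mul _).add (hv2.const_mul _)).add
      (f2.const_mul _)) intervalIntegrable_const,
    intervalIntegral.integral_add ((f1.const_mul _).add (hv2.const_mul _)) (f2.const_mul _),
    intervalIntegral.integral_add (f1.const_mul _) (hv2.const_mul _),
    intervalIntegral.integral_const_mul, intervalIntegral.integral_const_mul,
    intervalIntegral.integral_const_mul, intervalIntegral.integral_const, integral_norm_sq_eq hT.le,
    hrev, smul_eq_mul, sub_zero] at hmono
  set P := ∫ s in (0 : ℝ)..T, ‖ψh s - ψ s‖ ^ 2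
  set S := ∫ s in (0 : ℝ)..T, ‖state T 𝒜 B x₀ u s - state T (fun _ => A) B x₀ u s‖ ^ 2
  have h3 : T * (α / (8 * T ^ 2) * I ^ 2) ≤ α / 8 * ‖v‖ ^ 2 := by
    have := mul_le_mul_of_nonneg_left hI (by positivity : 0 ≤ α / (8 * T))
    have h4 : α / (8 * T) * (T * ‖v‖ ^ 2) = α / 8 * ‖v‖ ^ 2 := by field_simp
    have h5 : T * (α / (8 * T ^ 2) * I ^ 2) = α / (8 * T) * I ^ 2 := by field_simp
    linarith
  have h4 : α / 4 * ‖v‖ ^ 2 ≤ 2 * b ^ 2 / α * P + 8 * T ^ 2 * b ^ 2 * c ^ 2 / α * S := by linarith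
  have h5 := mul_le_mul_of_nonneg_left h4 (by positivity : 0 ≤ 4 * α)
  have h6 : 4 * α * (2 * b ^ 2 / α * P + 8 * T ^ 2 * b ^ 2 * c ^ 2 / α * S) =
      8 * b ^ 2 * P + 32 * c ^ 2 * b ^ 2 * T ^ 2 * S := by
    field_simp
    ring
  linarith

end Comparison

/-! ### Dissipativity and unbiasedness of the random matrices. -/

section RandomSystem

variable {N M K : ℕ} {Am : Fin M → Matrix (Fin N) (Fin N) ℝ} {p : Finset (Fin M) → ℝ}

theorem inner_selectedMatrix_le
    (hAm : ∀ m, ∀ x : EuclideanSpace ℝ (Fin N), inner ℝ x ((Am m).toEuclideanLin x) ≤ 0)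
    (hπ : ∀ m, 0 < inclusionProb p m) (S : Finset (Fin M)) (v : EuclideanSpace ℝ (Fin N)) :
    inner ℝ v (Matrix.toEuclideanCLM (𝕜 := ℝ) (selectedMatrix Am p S) v) ≤ 0 := by
  rw [selectedMatrix, map_sum, _root_.sum_apply, inner_sum]
  refine Finset.sum_nonpos fun m _ => ?_
  rw [map_smul, _root_.smul_apply, inner_smul_right]
  exact mul_nonpos_of_nonneg_of_nonpos (inv_nonneg.2 (hπ m).le) (hAm m v)

/-- The selected matrix is an unbiased estimator of the full one. -/
theorem sum_smul_selectedMatrix (hπ : ∀ m, 0 < inclusionProb p m) :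
    ∑ S, p S • selectedMatrix Am p S = ∑ m, Am m := by
  have h : ∀ S, p S • selectedMatrix Am p S =
      ∑ m, if m ∈ S then (p S * (inclusionProb p m)⁻¹) • Am m else 0 := fun S => by
    rw [selectedMatrix, Finset.smul_sum, Finset.sum_ite_mem, Finset.univ_inter]
    exact Finset.sum_congr rfl fun m _ => smul_smul _ _ _
  rw [Finset.sum_congr rfl fun S _ => h S, Finset.sum_comm]
  refine Finset.sum_congr rfl fun m _ => ?_
  -- After exchanging the sums, `Am m` carries the total probability of the subsets containing `m`,
  -- divided by that same probability.
  rw [← Finset.sum_filter, ← Finset.sum_smul, ← Finset.sum_mul]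
  change (inclusionProb p m * (inclusionProb p m)⁻¹) • Am m = Am m
  rw [mul_inv_cancel₀ (hπ m).ne', one_smul]

theorem randomMatrix_eq {τ : Fin (K + 1) → ℝ} (hτ : StrictMono τ) (ω : Fin K → Finset (Fin M))
    (k : Fin K) {s : ℝ} (hs : s ∈ Set.Ioo (τ k.castSucc) (τ k.succ)) :
    randomMatrix Am p τ ω s = selectedMatrix Am p (ω k) := by
  rw [randomMatrix, Finset.sum_eq_single k]
  · exact Set.indicator_of_mem (Set.Ioo_subset_Ico_self hs) _
  · intro j _ hjk
    refine Set.indicator_of_notMem (fun hj => ?_) _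
    rcases lt_or_gt_of_ne hjk with h | h
    · exact (hj.2.trans_le (hτ.monotone (Fin.succ_le_castSucc_iff.2 h))).not_gt hs.1
    · exact (hs.2.trans_le (hτ.monotone (Fin.succ_le_castSucc_iff.2 h))).not_ge hj.1
  · simp

theorem isDissipativeSystem_randomMatrix
    (hAm : ∀ m, ∀ x : EuclideanSpace ℝ (Fin N), inner ℝ x ((Am m).toEuclideanLin x) ≤ 0)
    (hπ : ∀ m, 0 < inclusionProb p m) (τ : Fin (K + 1) → ℝ) (ω : Fin K → Finset (Fin M)) :
    IsDissipativeSystem fun s => Matrix.toEuclideanCLM (𝕜 := ℝ) (randomMatrix Am p τ ω s) where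
  stronglyMeasurable := by
    simp_rw [toEuclideanCLM_randomMatrix]
    exact Finset.stronglyMeasurable_fun_sum _ fun k _ =>
      stronglyMeasurable_const.indicator measurableSet_Ico
  bounded := ⟨∑ k, ‖Matrix.toEuclideanCLM (𝕜 := ℝ) (selectedMatrix Am p (ω k))‖, fun s => by
    rw [toEuclideanCLM_randomMatrix]
    exact (norm_sum_le _ _).trans (Finset.sum_le_sum fun k _ => norm_indicator_le_norm_self _ _)⟩
  inner_le s v := by
    rw [toEuclideanCLM_randomMatrix, _root_.sum_apply, inner_sum]
    refine Finset.sum_nonpos fun k _ => ?_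
    by_cases h : s ∈ Set.Ico (τ k.castSucc) (τ k.succ)
    · simpa [h] using inner_selectedMatrix_le hAm hπ (ω k) v
    · simp [h]

end RandomSystem

/-! ### Expectation of the comparison estimate and conclusion. -/

/-- The constant in the error estimate, in terms of bounds `a`, `b`, `c` for the norms of `A`, `B`,
`Q`, a bound `X` for the states and a bound `Y` for the adjoint states. -/
noncomputable def errorConst (T a b c X Y : ℝ) : ℝ :=
  8 * b ^ 2 * (T * ((2 + a) * Y ^ 2 * T * Real.exp (a * T * T))) +
    32 * c ^ 2 * b ^ 2 * T ^ 2 * (T * ((2 + a) * X ^ 2 * T * Real.exp (a * T * T)))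

theorem errorConst_nonneg {T a b c X Y : ℝ} (hT : 0 ≤ T) (ha : 0 ≤ a) :
    0 ≤ errorConst T a b c X Y := by
  unfold errorConst
  positivity

theorem isDissipativeSystem_of_sum {N M : ℕ} {A : Matrix (Fin N) (Fin N) ℝ}
    {Am : Fin M → Matrix (Fin N) (Fin N) ℝ} (hAsum : A = ∑ m, Am m)
    (hAm : ∀ m, ∀ x : EuclideanSpace ℝ (Fin N), inner ℝ x ((Am m).toEuclideanLin x) ≤ 0) :
    IsDissipativeSystem fun _ => Matrix.toEuclideanCLM (𝕜 := ℝ) A where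
  stronglyMeasurable := stronglyMeasurable_const
  bounded := ⟨_, fun _ => le_rfl⟩
  inner_le _ v := by
    rw [hAsum, map_sum, _root_.sum_apply, inner_sum]
    exact Finset.sum_nonpos fun m _ => hAm m v

/-- Mean square distance of the minimizers. -/
theorem sq_mul_expect_norm_sq_le {N q : ℕ}
    {A : Matrix (Fin N) (Fin N) ℝ} {B : Matrix (Fin N) (Fin q) ℝ} {x₀ : EuclideanSpace ℝ (Fin N)}
    {Q : Matrix (Fin N) (Fin N) ℝ} {R : Matrix (Fin q) (Fin q) ℝ}
    {T : ℝ} (hT : 0 < T) {xd : L2 T N} {b c : ℝ} (hb : 0 < b)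
    (hB : ∀ z, ‖B.toEuclideanLin z‖ ≤ b * ‖z‖) (hQc : ∀ z, ‖Q.toEuclideanLin z‖ ≤ c * ‖z‖)
    {M : ℕ} {Am : Fin M → Matrix (Fin N) (Fin N) ℝ} {p : Finset (Fin M) → ℝ}
    {K : ℕ} {τ : Fin (K + 1) → ℝ} (hAsum : A = ∑ m, Am m)
    (hAm : ∀ m, ∀ x : EuclideanSpace ℝ (Fin N), inner ℝ x ((Am m).toEuclideanLin x) ≤ 0)
    (hp : ∀ S, 0 ≤ p S) (hp1 : ∑ S, p S = 1) (hπ : ∀ m, 0 < inclusionProb p m)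
    (hτ : StrictMono τ) (hτ0 : τ 0 = 0) (hτT : τ (Fin.last K) = T)
    {u : L2 T q} {w : (Fin K → Finset (Fin M)) → L2 T q} {α : ℝ} (hα : 0 < α)
    (h1 : ∀ v, 0 ≤ costDeriv T (fun _ => A) B x₀ Q R xd u v)
    (h2 : ∀ ω, costDeriv T (randomMatrix Am p τ ω) B x₀ Q R xd u (w ω - u) ≤
      -(α / 2 * ‖w ω - u‖ ^ 2)) :
    α ^ 2 * expect p (fun ω => ‖w ω - u‖ ^ 2) ≤
      errorConst T ‖Matrix.toEuclideanCLM (𝕜 := ℝ) A‖ b c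
        (‖x₀‖ + 2 * ∫ s in (0 : ℝ)..T, ‖B.toEuclideanLin (u s)‖)
        (2 * ∫ s in (0 : ℝ)..T,
          ‖Q.toEuclideanLin (state T (fun _ => A) B x₀ u (T - s) - xd (T - s))‖) *
        gridSpacing τ * splittingVar A Am p := by
  have hAd : IsDissipativeSystem fun _ => Matrix.toEuclideanCLM (𝕜 := ℝ) A :=
    isDissipativeSystem_of_sum hAsum hAm
  have hRd := isDissipativeSystem_randomMatrix hAm hπ τ
  have hh : ∀ k : Fin K, τ k.succ - τ k.castSucc ≤ gridSpacing τ := fun k =>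
    le_ciSup (f := fun k : Fin K => τ k.succ - τ k.castSucc) (Set.finite_range _).bddAbove k
  have hh0 : 0 ≤ gridSpacing τ :=
    Real.iSup_nonneg fun k => sub_nonneg.2 (hτ.monotone (Fin.castSucc_lt_succ).le)
  have hx := isPrimitiveOn_state hT.le hAd B x₀ u
  have hxh := fun ω => isPrimitiveOn_state hT.le (hRd ω) B x₀ u
  have hBu := intervalIntegrable_control hT.le B u
  have hg : IntervalIntegrable
      (fun s => Q.toEuclideanLin (state T (fun _ => A) B x₀ u (T - s) - xd (T - s)))
      volume 0 T := by
    simpa using ((intervalIntegrable_source hT.le hAd B x₀ Q xd u).comp_sub_left T).symm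
  obtain ⟨ψ, hψ0, hψ⟩ := (hAd.adjointReverse T).exists_isPrimitiveOn hT.le hg 0
  choose ψh hψh0 hψh using fun ω =>
    ((hRd ω).adjointReverse T).exists_isPrimitiveOn hT.le hg 0
  have hunb : ∑ S, p S • (Matrix.toEuclideanCLM (𝕜 := ℝ) (selectedMatrix Am p S) -
      Matrix.toEuclideanCLM (𝕜 := ℝ) A) = 0 := by
    have h := congrArg (Matrix.toEuclideanCLM (𝕜 := ℝ)) (sum_smul_selectedMatrix (Am := Am) hπ)
    rw [← hAsum, map_sum] at h
    simp only [smul_sub, Finset.sum_sub_distrib, ← Finset.sum_smul, hp1, one_smul]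
    simp only [map_smul] at h
    rw [h, sub_self]
  set X := ‖x₀‖ + 2 * ∫ s in (0 : ℝ)..T, ‖B.toEuclideanLin (u s)‖
  set Y := 2 * ∫ s in (0 : ℝ)..T,
    ‖Q.toEuclideanLin (state T (fun _ => A) B x₀ u (T - s) - xd (T - s))‖
  have hVar : ∑ S, ‖Matrix.toEuclideanCLM (𝕜 := ℝ) (selectedMatrix Am p S) -
      Matrix.toEuclideanCLM (𝕜 := ℝ) A‖ ^ 2 * p S = splittingVar A Am p := by
    simp only [splittingVar, map_sub]
  have hfwd : ∀ t ∈ Set.Icc 0 T, expect p (fun ω => ‖state T (randomMatrix Am p τ ω) B x₀ u t -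
      state T (fun _ => A) B x₀ u t‖ ^ 2) ≤ _ := fun t ht =>
    expect_norm_sq_sub_le hp hp1 (inner_selectedMatrix_le hAm hπ) hunb hτ hτ0 hτT hh hh0
      (Equiv.refl _) (fun ω => (hRd ω).inner_le)
      (fun ω k s hs => by rw [randomMatrix_eq hτ ω k hs, Equiv.refl_apply])
      hx.1 (fun ω => (hxh ω).1) (fun ω => (hxh ω).2.trans hx.2.symm) (X := X)
      (fun s hs => by
        have h := norm_le_of_dissipative hAd.inner_le hx.1 hBu hs
        rwa [hx.2] at h)
      (fun ω s hs => by
        have h := norm_le_of_dissipative (hRd ω).inner_le (hxh ω).1 hBu hs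
        rwa [(hxh ω).2] at h) ht
  -- The same error bound for the adjoints in reversed time. The grid is reflected and its `k`-th
  -- cell uses selection `k.rev`, so at the start of a cell only selections later in the original
  -- time have acted.
  have hbwd : ∀ t ∈ Set.Icc 0 T, expect p (fun ω => ‖ψh ω t - ψ t‖ ^ 2) ≤ _ := fun t ht =>
    expect_norm_sq_sub_le hp hp1
      (G := fun S => ContinuousLinearMap.adjoint
        (Matrix.toEuclideanCLM (𝕜 := ℝ) (selectedMatrix Am p S)))
      (fun S v => by
        rw [ContinuousLinearMap.adjoint_inner_right, real_inner_comm]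
        exact inner_selectedMatrix_le hAm hπ S v)
      (by
        have h := congrArg ContinuousLinearMap.adjoint hunb
        simpa only [map_sum, map_smulₛₗ, map_sub, map_zero, conj_trivial] using h)
      (τ := fun k => T - τ k.rev) (h := gridSpacing τ)
      (fun i j hij => sub_lt_sub_left (hτ (Fin.rev_lt_rev.2 hij)) T)
      (by simp [hτT]) (by simp [hτ0])
      (fun k => by
        have := hh k.rev
        simp only [Fin.rev_succ, Fin.rev_castSucc]
        linarith) hh0
      Fin.revPerm (fun ω => ((hRd ω).adjointReverse T).inner_le)
      (fun ω k s hs => by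
        simp only [Fin.rev_succ, Fin.rev_castSucc] at hs
        rw [randomMatrix_eq hτ ω k.rev ⟨by linarith [hs.2], by linarith [hs.1]⟩, Fin.revPerm_apply])
      hψ hψh (fun ω => (hψh0 ω).trans hψ0.symm) (X := Y)
      (fun s hs => by
        have h := norm_le_of_dissipative (hAd.adjointReverse T).inner_le hψ hg hs
        rwa [hψ0, norm_zero, zero_add] at h)
      (fun ω s hs => by
        have h := norm_le_of_dissipative ((hRd ω).adjointReverse T).inner_le (hψh ω) hg hs
        rwa [hψh0, norm_zero, zero_add] at h) ht
  -- Taking adjoints is isometric, so the variance and the norm of `A` are the same backward as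
  -- forward.
  simp only [← map_sub, LinearIsometryEquiv.norm_map] at hbwd
  simp only [← map_sub] at hVar hfwd
  rw [hVar] at hfwd hbwd
  have hint : ∀ {z : (Fin K → Finset (Fin M)) → ℝ → EuclideanSpace ℝ (Fin N)} {κ : ℝ},
      (∀ ω, ContinuousOn (z ω) (Set.Icc 0 T)) →
      (∀ t ∈ Set.Icc 0 T, expect p (fun ω => ‖z ω t‖ ^ 2) ≤ κ) →
      expect p (fun ω => ∫ s in (0 : ℝ)..T, ‖z ω s‖ ^ 2) ≤ T * κ := fun {z κ} hz hκ => by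
    have hzi := fun ω => (hz ω).norm.pow 2
    rw [← integral_expect fun ω => ContinuousOn.intervalIntegrable (by
      rw [Set.uIcc_of_le hT.le]; exact hzi ω)]
    refine (intervalIntegral.integral_mono_on hT.le (ContinuousOn.intervalIntegrable (by
      rw [Set.uIcc_of_le hT.le]; exact continuousOn_expect hzi))
      intervalIntegrable_const hκ).trans ?_
    simp
  have hf := hint (fun ω => ((hxh ω).1.sub hx.1).continuousOn) hfwd
  have hb' := hint (fun ω => ((hψh ω).sub hψ).continuousOn) hbwd
  have hfin := expect_mono hp fun ω =>
    sq_mul_norm_sq_le hT hAd (hRd ω) hα hb hB hQc (h1 _) (h2 ω) hψ0 (hψh0 ω) hψ (hψh ω)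
  rw [expect_add, expect_const_mul, expect_const_mul, expect_const_mul] at hfin
  refine hfin.trans ((add_le_add (mul_le_mul_of_nonneg_left hb' (by positivity))
    (mul_le_mul_of_nonneg_left hf (by positivity))).trans (le_of_eq ?_))
  unfold errorConst
  ring

end RandomSplitting

theorem theorem4 {N q : ℕ}
    -- the original problem: system, weights, horizon, target
    (A : Matrix (Fin N) (Fin N) ℝ) (B : Matrix (Fin N) (Fin q) ℝ) (x₀ : EuclideanSpace ℝ (Fin N))
    (Q : Matrix (Fin N) (Fin N) ℝ) (hQ : Q.PosSemidef)
    (R : Matrix (Fin q) (Fin q) ℝ) (hR : R.PosDef)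
    (T : ℝ) (hT : 0 < T) (xd : RandomSplitting.L2 T N) :
    -- the constant depends on these data only
    ∃ C : ℝ,
      ∀ (M : ℕ) (Am : Fin M → Matrix (Fin N) (Fin N) ℝ) (p : Finset (Fin M) → ℝ)
        (K : ℕ) (τ : Fin (K + 1) → ℝ),
        -- the splitting: `A = ∑ A_m` with dissipative `A_m`
        A = ∑ m, Am m →
        (∀ m, ∀ x : EuclideanSpace ℝ (Fin N), inner ℝ x ((Am m).toEuclideanLin x) ≤ 0) →
        -- the selection probabilities
        (∀ S, 0 ≤ p S) → ∑ S, p S = 1 → (∀ m, 0 < RandomSplitting.inclusionProb p m) →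
        -- the grid `0 = t_0 < t_1 < ... < t_K = T`
        StrictMono τ → τ 0 = 0 → τ (Fin.last K) = T →
        -- the minimizers of `J` and of `J_h(ω, ·)`
        ∀ (ustar : RandomSplitting.L2 T q)
          (uhstar : (Fin K → Finset (Fin M)) → RandomSplitting.L2 T q),
          IsMinOn (RandomSplitting.cost T (fun _ => A) B x₀ Q R xd) Set.univ ustar →
          (∀ ω, IsMinOn
            (RandomSplitting.cost T (RandomSplitting.randomMatrix Am p τ ω) B x₀ Q R xd)
            Set.univ (uhstar ω)) →
          (∀ α : ℝ, 0 ≤ α →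
            (∀ ω, StrongConvexOn Set.univ α
              (RandomSplitting.cost T (RandomSplitting.randomMatrix Am p τ ω) B x₀ Q R xd)) →
            α ^ 2 * RandomSplitting.expect p (fun ω => ‖uhstar ω - ustar‖ ^ 2) ≤
              C * RandomSplitting.gridSpacing τ * RandomSplitting.splittingVar A Am p) ∧
          RandomSplitting.expect p (fun ω => ‖uhstar ω - ustar‖ ^ 2) ≤
            C * RandomSplitting.gridSpacing τ * RandomSplitting.splittingVar A Am p := by
  have hQs : Q.toEuclideanLin.IsSymmetric := Matrix.isSymmetric_toEuclideanLin_iff.2 hQ.isHermitian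
  have hRs : R.toEuclideanLin.IsSymmetric := Matrix.isSymmetric_toEuclideanLin_iff.2 hR.isHermitian
  have hQ0 : ∀ z, 0 ≤ inner ℝ z (Q.toEuclideanLin z) := fun z => by
    rw [real_inner_comm]
    exact (Matrix.isPositive_toEuclideanLin_iff.2 hQ).2 z
  obtain ⟨r, hr0, hr⟩ := RandomSplitting.exists_coercive hR
  have hR0 : ∀ z, 0 ≤ inner ℝ z (R.toEuclideanLin z) := fun z => le_trans (by positivity) (hr z)
  -- The constant involves the minimizer yet must precede the splitting, so a minimizer is fixed
  -- here and identified with `ustar` later. If none exists, the claim is vacuous.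
  by_cases hex : ∃ u₀, IsMinOn (RandomSplitting.cost T (fun _ => A) B x₀ Q R xd) Set.univ u₀
  swap
  · exact ⟨0, fun _ _ _ _ _ _ _ _ _ _ _ _ _ u _ hu => absurd ⟨u, hu⟩ hex⟩
  obtain ⟨u₀, hu₀⟩ := hex
  set C := RandomSplitting.errorConst T ‖Matrix.toEuclideanCLM (𝕜 := ℝ) A‖
    -- The added `1` keeps this bound positive when `B = 0`.
    (‖LinearMap.toContinuousLinearMap B.toEuclideanLin‖ + 1)
    ‖LinearMap.toContinuousLinearMap Q.toEuclideanLin‖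
    (‖x₀‖ + 2 * ∫ s in (0 : ℝ)..T, ‖B.toEuclideanLin (u₀ s)‖)
    (2 * ∫ s in (0 : ℝ)..T, ‖Q.toEuclideanLin
      (RandomSplitting.state T (fun _ => A) B x₀ u₀ (T - s) - xd (T - s))‖) with hC
  have hC0 : 0 ≤ C := RandomSplitting.errorConst_nonneg hT.le (norm_nonneg _)
  -- The summand `1` serves the `α`-convex estimate; `1 / r ^ 2` serves the unconditional one,
  -- obtained with `α = r` and division by `r ^ 2`.
  refine ⟨C * (1 + 1 / r ^ 2), fun M Am p K τ hAsum hAm hp hp1 hπ hτ hτ0 hτT ustar uhstar hu huh =>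
    ?_⟩
  have hAd : RandomSplitting.IsDissipativeSystem fun _ => Matrix.toEuclideanCLM (𝕜 := ℝ) A :=
    RandomSplitting.isDissipativeSystem_of_sum hAsum hAm
  have hRd := RandomSplitting.isDissipativeSystem_randomMatrix hAm hπ τ
  -- Uniqueness: the derivative at `ustar` along `u₀ - ustar` is nonnegative, yet coercivity makes
  -- it negative unless the two agree.
  obtain rfl : u₀ = ustar := by
    have h1 := RandomSplitting.costDeriv_nonneg hT.le hAd hQs hRs hu (u₀ - ustar)
    have h2 := RandomSplitting.costDeriv_le_of_coercive hT.le hAd hQs hRs hQ0 hr hu₀ ustar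
    have h3 : ‖u₀ - ustar‖ ^ 2 ≤ 0 := by
      by_contra! h
      have := mul_pos (half_pos hr0) h
      linarith
    have h4 : ‖u₀ - ustar‖ = 0 := pow_eq_zero_iff two_ne_zero |>.1 (le_antisymm h3 (sq_nonneg _))
    exact sub_eq_zero.1 (norm_eq_zero.1 h4)
  have hh0 : 0 ≤ RandomSplitting.gridSpacing τ :=
    Real.iSup_nonneg fun k => sub_nonneg.2 (hτ.monotone (Fin.castSucc_lt_succ).le)
  have hV0 : 0 ≤ RandomSplitting.splittingVar A Am p :=
    Finset.sum_nonneg fun S _ => mul_nonneg (sq_nonneg _) (hp S)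
  have key : ∀ α : ℝ, 0 < α → (∀ ω, RandomSplitting.costDeriv T
      (RandomSplitting.randomMatrix Am p τ ω) B x₀ Q R xd u₀ (uhstar ω - u₀) ≤
        -(α / 2 * ‖uhstar ω - u₀‖ ^ 2)) →
      α ^ 2 * RandomSplitting.expect p (fun ω => ‖uhstar ω - u₀‖ ^ 2) ≤
        C * RandomSplitting.gridSpacing τ * RandomSplitting.splittingVar A Am p :=
    fun α hα hω => RandomSplitting.sq_mul_expect_norm_sq_le hT (by positivity)
      (fun z => ((LinearMap.toContinuousLinearMap B.toEuclideanLin).le_opNorm z).trans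
        (mul_le_mul_of_nonneg_right (by linarith) (norm_nonneg _)))
      (fun z => (LinearMap.toContinuousLinearMap Q.toEuclideanLin).le_opNorm z)
      hAsum hAm hp hp1 hπ hτ hτ0 hτT hα
      (RandomSplitting.costDeriv_nonneg hT.le hAd hQs hRs hu) hω
  have hle : C * RandomSplitting.gridSpacing τ * RandomSplitting.splittingVar A Am p * (1 / r ^ 2)
      + C * RandomSplitting.gridSpacing τ * RandomSplitting.splittingVar A Am p =
      C * (1 + 1 / r ^ 2) * RandomSplitting.gridSpacing τ *
        RandomSplitting.splittingVar A Am p := by ring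
  rw [← hle]
  have hD0 : 0 ≤ C * RandomSplitting.gridSpacing τ * RandomSplitting.splittingVar A Am p := by
    positivity
  constructor
  · intro α hα0 hconv
    have hmul := mul_nonneg hD0 (by positivity : 0 ≤ 1 / r ^ 2)
    rcases hα0.eq_or_lt with rfl | hα
    · rw [zero_pow two_ne_zero, zero_mul]
      exact add_nonneg hmul hD0
    · linarith [key α hα fun ω => RandomSplitting.costDeriv_le_of_strongConvexOn hT.le (hRd ω)
        hQs hRs hQ0 hR0 (hconv ω) (huh ω) u₀]
  · have h := key r hr0 fun ω => RandomSplitting.costDeriv_le_of_coercive hT.le (hRd ω) hQs hRs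
      hQ0 hr (huh ω) u₀
    rw [mul_comm, ← le_div_iff₀ (by positivity), div_eq_mul_one_div] at h
    linarith
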